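/- Let $(M,g)$ be a smooth compact Riemannian manifold with (possibly empty) boundary, of dimension $n\ge 1$, with volume measure $dV$, induced surface measure $dS$ on $\partial M$ and outward unit normal $\nu$. Let $E=M\times\mathbb C^m$ carry the standard Hermitian inner product $\langle a,b\rangle=\sum_k a_k\bar b_k$. For a smooth $m\times m$ matrix $A=A_j\,dx^j$ of complex one-forms put $d_Au=du+Au$; $A$ is a unitary connection if $d\langle u,v\rangle=\langle d_Au,v\rangle+\langle u,d_Av\rangle$ for all $u,v\in C^\infty(M;E)$. Let $d_A^*$ be the formal adjoint of $d_A$ for the inner products $(u,v)_M=\int_M\langle u,v\rangle\,dV$ on sections and $\int_M g^{ij}\langle\alpha_i,\beta_j\rangle\,dV$ on $E$-valued one-forms, and for a smooth $Q:M\to\mathbb C^{m\times m}$ put $\mathcal L_{A,Q}=d_A^*d_A+Q$. Assume that $0$ is not a Dirichlet eigenvalue of $\mathcal L_{A,Q}$, i.e. $\mathcal L_{A,Q}u=0$, $u|_{\partial M}=0$ has only the solution $u=0$ in $C^\infty(M;E)$. For $f$ on $\partial M$ such that the Dirichlet problem $\mathcal L_{A,Q}u=0$, $u|_{\partial M}=f$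 has a solution $u\in C^\infty(M;E)$ (which is then unique), the Dirichlet-to-Neumann map is $\Lambda_{A,Q}f=d_Au(\nu)|_{\partial M}$. Write $(h,k)_{\partial M}=\int_{\partial M}\langle h,k\rangle\,dS$ and $|A|^2=g^{ij}A_iA_j$ (a matrix-valued function, not a norm). **Theorem.** Let $A,B$ be smooth unitary connections on $E$ and $Q_A,Q_B$ smooth potentials, such that $0$ is not a Dirichlet eigenvalue of $\mathcal L_{A,Q_A}$ nor of $\mathcal L_{B,Q_B}$. Let $f,g$ be smooth sections of $E|_{\partial M}$, and let $u,v\in C^\infty(M;E)$ solve $\mathcal L_{A,Q_A}u=0$, $u|_{\partial M}=f$ and $\mathcal L_{B,Q_B^*}v=0$, $v|_{\partial M}=g$; let also $\Lambda_{B,Q_B}f$ be defined, i.e. let the problem $\mathcal L_{B,Q_B}w=0$, $w|_{\partial M}=f$ have a solution $w\in C^\infty(M;E)$. Then $$\big((\Lambda_{A,Q_A}-\Lambda_{B,Q_B})f,g\big)_{\partial M}=\Big(\big(Q_A-Q_B+|B|^2-|A|^2\big)u,v\Big)_M+\int_M g^{ij}\big((A-B)_j\big)_{kl}\Big(u_l\frac{\partial\bar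 v_k}{\partial x^i}-\frac{\partial u_l}{\partial x^i}\bar v_k\Big)dV .$$ For $m=1$ the last integral can be written as $\int_M\langle u\,d\bar v-\bar v\,du,\,B-A\rangle_g\,dV$, where $\langle\alpha,\beta\rangle_g=g^{ij}\alpha_i\overline{\beta_j}$. Matrix version: let $\mathcal L_{A,Q}$ and $\Lambda_{A,Q}$ act on $\mathbb C^{m\times m}$-valued functions column by column, and let $(X,Y)$ denote the $L^2$ inner products induced by $\langle X,Y\rangle=\operatorname{Tr}(XY^*)$ (and by $g^{ij}\operatorname{Tr}(X_iY_j^*)$ on one-forms). Let $F,G$ be smooth $\mathbb C^{m\times m}$-valued functions on $\partial M$, let the smooth $\mathbb C^{m\times m}$-valued functions $U,V$ on $M$ solve $\mathcal L_{A,Q_A}U=0$, $U|_{\partial M}=F$ and $\mathcal L_{B,Q_B^*}V=0$, $V|_{\partial M}=G$, and let $\Lambda_{B,Q_B}F$ be defined. Then $$\big((\Lambda_{A,Q_A}-\Lambda_{B,Q_B})F,G\big)_{\partial M}=\Big(\big(Q_A-Q_B+|B|^2-|A|^2\big)U,V\Big)_M+\big(U(dV^*)-(dU)V^*,\,B-A\big)_M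 .$$ -/

import Mathlib

open MeasureTheory Set Bundle
open scoped Manifold ContDiff Matrix ComplexConjugate

noncomputable section

namespace ConnectionCalderon

/-! The dimension of the manifold is `d + 1`.  A chart takes values in the half space
`{y ∈ ℝ^{d+1} | 0 ≤ y₀}`, and the boundary of the manifold corresponds to `y₀ = 0`. -/

/-- Complex-valued one-forms, that is complex covectors at each point. -/
abbrev OneForm (d : ℕ) (M : Type*) [TopologicalSpace M]
    [ChartedSpace (EuclideanHalfSpace (d + 1)) M] : Type _ :=
  ∀ x : M, TangentSpace (𝓡∂ (d + 1)) x →L[ℝ] ℂ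

/-- A smooth Riemannian metric on `M`. -/
abbrev Metric (d : ℕ) (M : Type*) [TopologicalSpace M]
    [ChartedSpace (EuclideanHalfSpace (d + 1)) M] [IsManifold (𝓡∂ (d + 1)) ∞ M] : Type _ :=
  ContMDiffRiemannianMetric (𝓡∂ (d + 1)) ∞ (EuclideanSpace ℝ (Fin (d + 1)))
    (fun x : M => TangentSpace (𝓡∂ (d + 1)) x)

variable {d m : ℕ} {M : Type*} [TopologicalSpace M]
  [ChartedSpace (EuclideanHalfSpace (d + 1)) M]

/-- A one-form is smooth if it is a smooth section of the bundle of complex covectors. -/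
def OneForm.IsSmooth [IsManifold (𝓡∂ (d + 1)) ∞ M] (η : OneForm d M) : Prop :=
  ContMDiff (𝓡∂ (d + 1))
    ((𝓡∂ (d + 1)).prod 𝓘(ℝ, EuclideanSpace ℝ (Fin (d + 1)) →L[ℝ] ℂ)) ∞
    (fun x : M => TotalSpace.mk' (EuclideanSpace ℝ (Fin (d + 1)) →L[ℝ] ℂ)
      (E := fun x : M => TangentSpace (𝓡∂ (d + 1)) x →L[ℝ] Bundle.Trivial M ℂ x) x (η x))

/-- Smooth sections of the trivial bundle `M × ℂ^m`. -/
def IsSmoothSection (d : ℕ) {m : ℕ} {M : Type*} [TopologicalSpace M]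
    [ChartedSpace (EuclideanHalfSpace (d + 1)) M] (u : M → Fin m → ℂ) : Prop :=
  ContMDiff (𝓡∂ (d + 1)) 𝓘(ℝ, Fin m → ℂ) ∞ u

/-- Smooth sections of the endomorphism bundle `M × ℂ^{m × m}`. -/
def IsSmoothPotential (d : ℕ) {m : ℕ} {M : Type*} [TopologicalSpace M]
    [ChartedSpace (EuclideanHalfSpace (d + 1)) M] (Q : M → Matrix (Fin m) (Fin m) ℂ) : Prop :=
  ∀ k l, ContMDiff (𝓡∂ (d + 1)) 𝓘(ℝ, ℂ) ∞ (fun x => Q x k l)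

/-! ### Local frames, the metric, volume and surface measure, the normal -/

/-- The coordinate vector `∂ᵢ` at `x` of the preferred chart at `x`. -/
def frame (x : M) (i : Fin (d + 1)) : TangentSpace (𝓡∂ (d + 1)) x :=
  (EuclideanSpace.single i (1 : ℝ) : EuclideanSpace ℝ (Fin (d + 1)))

/-- The coordinate vector `∂ᵢ` at `x` of the preferred chart at `a`
(meaningful for `x` in the domain of that chart). -/
def chartFrame [IsManifold (𝓡∂ (d + 1)) ∞ M] (a x : M) (i : Fin (d + 1)) :
    TangentSpace (𝓡∂ (d + 1)) x :=
  tangentCoordChange (𝓡∂ (d + 1)) a x x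
    (EuclideanSpace.single i (1 : ℝ) : EuclideanSpace ℝ (Fin (d + 1)))

/-- The covariant derivative `d_A u = du + A u`, for a matrix `A` of one-forms. -/
def covDeriv (A : Matrix (Fin m) (Fin m) (OneForm d M)) (u : M → Fin m → ℂ) (x : M) :
    TangentSpace (𝓡∂ (d + 1)) x →L[ℝ] (Fin m → ℂ) :=
  (show TangentSpace (𝓡∂ (d + 1)) x →L[ℝ] (Fin m → ℂ) from
    mfderiv (𝓡∂ (d + 1)) 𝓘(ℝ, Fin m → ℂ) u x)
    + ContinuousLinearMap.pi fun k => ∑ l, u x l • A k l x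

/-- The differential of a complex-valued function. -/
def differential (d : ℕ) {M : Type*} [TopologicalSpace M] [ChartedSpace (EuclideanHalfSpace (d + 1)) M]
    (φ : M → ℂ) : OneForm d M :=
  fun x => mfderiv (𝓡∂ (d + 1)) 𝓘(ℝ, ℂ) φ x

/-- The standard Hermitian inner product of `ℂ^m`, linear in the first slot. -/
def herm {m : ℕ} (a b : Fin m → ℂ) : ℂ := ∑ k, a k * conj (b k)

/-- The matrix `A_j` in `A = A_j dx^j` at `x`, in the preferred chart at `x`. -/
def component (A : Matrix (Fin m) (Fin m) (OneForm d M)) (x : M) (j : Fin (d + 1)) :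
    Matrix (Fin m) (Fin m) ℂ :=
  Matrix.of fun k l => A k l x (frame x j)

/-- The connection `d_A` is smooth and unitary:
`d⟨u, v⟩ = ⟨d_A u, v⟩ + ⟨u, d_A v⟩` for all smooth sections `u`, `v`. -/
structure IsUnitaryConnection [IsManifold (𝓡∂ (d + 1)) ∞ M]
    (A : Matrix (Fin m) (Fin m) (OneForm d M)) : Prop where
  smooth : ∀ k l, OneForm.IsSmooth (A k l)
  metric : ∀ u v : M → Fin m → ℂ, IsSmoothSection d u → IsSmoothSection d v →
    ∀ (x : M) (X : TangentSpace (𝓡∂ (d + 1)) x),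
      differential d (fun y => herm (u y) (v y)) x X
        = herm (covDeriv A u x X) (v x) + herm (u x) (covDeriv A v x X)

variable [IsManifold (𝓡∂ (d + 1)) ∞ M] (g : Metric d M)

/-- The matrix `g_{ij}` at `x`, in the preferred chart at `x`. -/
def gram (x : M) : Matrix (Fin (d + 1)) (Fin (d + 1)) ℝ :=
  Matrix.of fun i j => g.inner x (frame x i) (frame x j)

/-- The matrix `g^{ij}` at `x`, in the preferred chart at `x`. -/
def invGram (x : M) : Matrix (Fin (d + 1)) (Fin (d + 1)) ℝ := (gram g x)⁻¹

/-- The matrix `g_{ij}` at `x`, in the preferred chart at `a`. -/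
def chartGram (a x : M) : Matrix (Fin (d + 1)) (Fin (d + 1)) ℝ :=
  Matrix.of fun i j => g.inner x (chartFrame a x i) (chartFrame a x j)

/-- The outward unit normal at a boundary point: `νⁱ = - g^{i0} / √(g^{00})`. It is orthogonal to
`∂₁, …, ∂_d`, which span the tangent space of the boundary, and `ν⁰ < 0`. -/
def outwardNormal (x : M) : TangentSpace (𝓡∂ (d + 1)) x :=
  ∑ i, (-(invGram g x i 0) / Real.sqrt (invGram g x 0 0)) • frame x i

/-- The measure `√(det g_{ij}) dy` of the preferred chart at `a`, carried to `M`. -/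
def chartVolume [MeasurableSpace M] (a : M) : Measure M :=
  (((volume : Measure (EuclideanSpace ℝ (Fin (d + 1)))).restrict
      (extChartAt (𝓡∂ (d + 1)) a).target).withDensity
    (fun y => ENNReal.ofReal
      (Real.sqrt (chartGram g a ((extChartAt (𝓡∂ (d + 1)) a).symm y)).det))).map
    (extChartAt (𝓡∂ (d + 1)) a).symm

/-- The inclusion `z ↦ (0, z)` of `ℝ^d` in `ℝ^{d+1}` as the boundary of the half space. -/
def boundaryIncl (z : EuclideanSpace ℝ (Fin d)) : EuclideanSpace ℝ (Fin (d + 1)) :=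
  WithLp.toLp 2 (Fin.cons 0 (fun i => z i))

/-- The measure `√(det (g_{ij})_{i,j ≥ 1}) dz` on the boundary part of the preferred chart at `a`,
carried to `M`. -/
def chartSurface [MeasurableSpace M] (a : M) : Measure M :=
  (((volume : Measure (EuclideanSpace ℝ (Fin d))).restrict
      {z | boundaryIncl z ∈ (extChartAt (𝓡∂ (d + 1)) a).target}).withDensity
    (fun z => ENNReal.ofReal (Real.sqrt
      ((chartGram g a ((extChartAt (𝓡∂ (d + 1)) a).symm (boundaryIncl z))).submatrix
        Fin.succ Fin.succ).det))).map
    (fun z => (extChartAt (𝓡∂ (d + 1)) a).symm (boundaryIncl z))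

/-- A smooth partition of unity subordinate to the domains of the preferred charts. -/
def chartPartition (d : ℕ) (M : Type*) [TopologicalSpace M]
    [ChartedSpace (EuclideanHalfSpace (d + 1)) M] [IsManifold (𝓡∂ (d + 1)) ∞ M]
    [T2Space M] [SigmaCompactSpace M] : SmoothPartitionOfUnity M (𝓡∂ (d + 1)) M univ :=
  (SmoothPartitionOfUnity.exists_isSubordinate_chartAt_source (𝓡∂ (d + 1)) M).choose

/-- The Riemannian volume measure `dV` on `M`, patched from the measures `√(det g) dy` of the
charts by a partition of unity. -/
def volumeMeasure [MeasurableSpace M] [T2Space M] [SigmaCompactSpace M] : Measure M :=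
  Measure.sum fun a : M =>
    (chartVolume g a).withDensity (fun x => ENNReal.ofReal (chartPartition d M a x))

/-- The Riemannian surface measure on the boundary of `M` (for the induced metric), patched
from the charts by a partition of unity. -/
def surfaceMeasure [MeasurableSpace M] [T2Space M] [SigmaCompactSpace M] :
    Measure ((𝓡∂ (d + 1)).boundary M) :=
  (Measure.sum fun a : M =>
    (chartSurface g a).withDensity (fun x => ENNReal.ofReal (chartPartition d M a x))).comap
    Subtype.val

/-! ### The connection Laplacian and the Dirichlet-to-Neumann map -/

/-- The inner product `g^{ij} αᵢ conj(βⱼ)` of two complex covectors at `x`. -/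
def formInner (x : M) (α β : TangentSpace (𝓡∂ (d + 1)) x →L[ℝ] ℂ) : ℂ :=
  ∑ i, ∑ j, (invGram g x i j : ℂ) * (α (frame x i) * conj (β (frame x j)))

/-- The inner product `g^{ij} ⟨αᵢ, βⱼ⟩` of two `ℂ^m`-valued covectors at `x`. -/
def vecFormInner (x : M) (α β : TangentSpace (𝓡∂ (d + 1)) x →L[ℝ] (Fin m → ℂ)) : ℂ :=
  ∑ i, ∑ j, (invGram g x i j : ℂ) * herm (α (frame x i)) (β (frame x j))

/-- The endomorphism `|A|² = g^{ij} Aᵢ Aⱼ` at `x`. -/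
def normSq (A : Matrix (Fin m) (Fin m) (OneForm d M)) (x : M) : Matrix (Fin m) (Fin m) ℂ :=
  ∑ i, ∑ j, (invGram g x i j : ℂ) • (component A x i * component A x j)

variable [MeasurableSpace M] [T2Space M] [SigmaCompactSpace M]

/-- `β = d_A^* α`, where `d_A^*` is the formal adjoint of `d_A`: the identity
`(β, φ)_{L²} = (α, d_A φ)_{L²}` holds for all smooth sections `φ` with compact support in the
interior of `M` (`M` is compact in all our uses). -/
def IsFormalAdjoint (A : Matrix (Fin m) (Fin m) (OneForm d M))
    (α : ∀ x : M, TangentSpace (𝓡∂ (d + 1)) x →L[ℝ] (Fin m → ℂ)) (β : M → Fin m → ℂ) : Prop :=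
  ∀ φ : M → Fin m → ℂ, IsSmoothSection d φ → HasCompactSupport φ →
    tsupport φ ⊆ (𝓡∂ (d + 1)).interior M →
    ∫ x, herm (β x) (φ x) ∂(volumeMeasure g)
      = ∫ x, vecFormInner g x (α x) (covDeriv A φ x) ∂(volumeMeasure g)

/-- `u ∈ C^∞(M; ℂ^m)` solves `d_A^* d_A u + Q u = 0` with `u = f` on the boundary. -/
structure IsDirichletSolution (A : Matrix (Fin m) (Fin m) (OneForm d M))
    (Q : M → Matrix (Fin m) (Fin m) ℂ) (f : (𝓡∂ (d + 1)).boundary M → Fin m → ℂ)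
    (u : M → Fin m → ℂ) : Prop where
  smooth : IsSmoothSection d u
  equation : IsFormalAdjoint g A (covDeriv A u) (fun x => -(Q x *ᵥ u x))
  boundary : ∀ p, u p.1 = f p

/-- `0` is not a Dirichlet eigenvalue of `d_A^* d_A + Q`. -/
def ZeroNotDirichletEigenvalue (A : Matrix (Fin m) (Fin m) (OneForm d M))
    (Q : M → Matrix (Fin m) (Fin m) ℂ) : Prop :=
  ∀ u : M → Fin m → ℂ, IsDirichletSolution g A Q (fun _ => 0) u → u = fun _ => 0

open Classical in
/-- The Dirichlet-to-Neumann map on smooth data: `Λ_{A,Q} f = ι_ν d_A u` on the boundary, where `u`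
is the solution of `d_A^* d_A u + Q u = 0` with `u = f` on the boundary; the solution is unique if
`0` is not a Dirichlet eigenvalue. (The value `0` is a dummy for data without a solution.) -/
def dnMap (A : Matrix (Fin m) (Fin m) (OneForm d M)) (Q : M → Matrix (Fin m) (Fin m) ℂ)
    (f : (𝓡∂ (d + 1)).boundary M → Fin m → ℂ) : (𝓡∂ (d + 1)).boundary M → Fin m → ℂ :=
  if h : ∃ u, IsDirichletSolution g A Q f u then
    fun p => covDeriv A h.choose p.1 (outwardNormal g p.1)
  else fun _ => 0

/-- The matrix version of the Dirichlet problem: `d_A^* d_A + Q` acts on matrix-valued functions by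
multiplication from the left, that is, on each column. -/
def IsDirichletSolutionMatrix (A : Matrix (Fin m) (Fin m) (OneForm d M))
    (Q : M → Matrix (Fin m) (Fin m) ℂ)
    (F : (𝓡∂ (d + 1)).boundary M → Matrix (Fin m) (Fin m) ℂ)
    (U : M → Matrix (Fin m) (Fin m) ℂ) : Prop :=
  ∀ j, IsDirichletSolution g A Q (fun p k => F p k j) (fun x k => U x k j)

/-- The Dirichlet-to-Neumann map on matrix-valued data, acting on each column. -/
def dnMapMatrix (A : Matrix (Fin m) (Fin m) (OneForm d M)) (Q : M → Matrix (Fin m) (Fin m) ℂ)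
    (F : (𝓡∂ (d + 1)).boundary M → Matrix (Fin m) (Fin m) ℂ) :
    (𝓡∂ (d + 1)).boundary M → Matrix (Fin m) (Fin m) ℂ :=
  fun p => Matrix.of fun k j => dnMap g A Q (fun q l => F q l j) p k

/-- The `L²(M)` inner product of sections of the trivial bundle. -/
def innerM (u v : M → Fin m → ℂ) : ℂ := ∫ x, herm (u x) (v x) ∂(volumeMeasure g)

/-- The `L²(∂M)` inner product of sections of the trivial bundle. -/
def innerBdry (h k : (𝓡∂ (d + 1)).boundary M → Fin m → ℂ) : ℂ :=
  ∫ p, herm (h p) (k p) ∂(surfaceMeasure g)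

/-- The `L²(M)` inner product of matrix-valued functions, for `⟨X, Y⟩ = Tr (X Y^*)`. -/
def innerMatrixM (U V : M → Matrix (Fin m) (Fin m) ℂ) : ℂ :=
  ∫ x, (U x * (V x)ᴴ).trace ∂(volumeMeasure g)

/-- The `L²(∂M)` inner product of matrix-valued functions, for `⟨X, Y⟩ = Tr (X Y^*)`. -/
def innerMatrixBdry (H K : (𝓡∂ (d + 1)).boundary M → Matrix (Fin m) (Fin m) ℂ) : ℂ :=
  ∫ p, (H p * (K p)ᴴ).trace ∂(surfaceMeasure g)

/-- The `L²(M)` inner product of two matrices of one-forms, for `g^{ij} Tr (αᵢ βⱼ^*)`. -/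
def innerMatrixForm (α β : Matrix (Fin m) (Fin m) (OneForm d M)) : ℂ :=
  ∫ x, ∑ i, ∑ j, (invGram g x i j : ℂ) * (component α x i * (component β x j)ᴴ).trace ∂(volumeMeasure g)

/-- The matrix of one-forms `U (dV^*) - (dU) V^*`. -/
def currentMatrix (d : ℕ) {m : ℕ} {M : Type*} [TopologicalSpace M]
    [ChartedSpace (EuclideanHalfSpace (d + 1)) M] (U V : M → Matrix (Fin m) (Fin m) ℂ) :
    Matrix (Fin m) (Fin m) (OneForm d M) :=
  Matrix.of fun k l x =>
    ∑ r, (U x k r • differential d (fun y => (V y)ᴴ r l) x - (V x)ᴴ r l • differential d (fun y => U y k r) x)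

end ConnectionCalderon

end

open ConnectionCalderon

/-!
# The integral identity for the Dirichlet-to-Neumann maps of connection Laplacians

The identity is Green's formula used three times. If `u` solves `(d_A^* d_A + Q) u = 0`, then
`(d_A u(ν), φ)_{∂M} = (d_A u, d_A φ)_M + (Q u, φ)_M` for every smooth `φ`. For `φ = v` this computes
`(Λ_A f, g)_{∂M}`. For `Λ_B f`, given by `d_B w(ν)`, the formula for `w` tested with `v` equals the
conjugate of the formula for `v` tested with `w`, because `v` solves the adjoint equation. The latter
formula sees only the boundary values of its test section, so that `w` may be replaced by `u`
(`innerBdry_dnMap_sub`). The difference is the integral of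
`⟨d_A u, d_A v⟩ - ⟨d_B u, d_B v⟩ + ⟨(Q_A - Q_B) u, v⟩`. A unitary connection is a skew-Hermitian matrix
of one-forms (`IsUnitaryConnection.conj_apply`), and expanding `⟨d_A u, d_A v⟩` accordingly
(`vecFormInner_covDeriv`) gives the stated right-hand side. The matrix version is the sum of the
vector versions over the columns.

The formal adjoint is defined by test sections with compact support in the interior, hence Green's
formula for test sections that reach the boundary (`green`) requires an argument; no divergence
theorem is needed. By a partition of unity the test section `φ` is supported in one chart
(`green_of_tsupport_subset`). There `χ(y₀ / ε) φ`, with `χ` vanishing on `(-∞, 1]` and equal to `1` on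
`[2, ∞)`, is admissible, and as `ε → 0` the two terms of `d_A (χ(y₀ / ε) φ)` contribute
* `χ(y₀ / ε) d_A φ`, which tends to `d_A φ` (`tendsto_integral_cutoff`);
* `ε⁻¹ χ'(y₀ / ε) dy₀ ⊗ φ`, whose kernel concentrates on the boundary by Fubini's theorem
  (`tendsto_integral_deriv_cutoff`) and leaves `∫ √(det g) g^{i0} ⟨αᵢ, φ⟩ dz` over `y₀ = 0`.

As `√(det g) √(g^{00})` is the surface density (`sqrt_det_mul_sqrt_inv`) and
`ν = -g^{i0} ∂ᵢ / √(g^{00})`, this is the boundary term. The volume measure and the normal are defined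
by preferred charts, so it also has to be checked that they have the same expression in every chart:
`chartVolume_restrict_source` is the change of variables formula, and `outwardNormal_eq_chart` holds
because a transition map preserves the half space, so that at the boundary its Jacobian has
first row `(c, 0, …, 0)` with `c > 0`.
-/

noncomputable section

namespace ConnectionCalderon

open Filter Topology

/-! ### Coordinate frames and the Gram matrix in different charts -/

section Frames

variable {d m : ℕ} {M : Type*} [TopologicalSpace M]
  [ChartedSpace (EuclideanHalfSpace (d + 1)) M] [IsManifold (𝓡∂ (d + 1)) ∞ M]

/-- The Jacobian matrix at `x` of the transition map from the preferred chart at `a` to the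
preferred chart at `b`; its column `i` is the image of the `i`-th coordinate vector. -/
def coordJacobian (d : ℕ) {M : Type*} [TopologicalSpace M]
    [ChartedSpace (EuclideanHalfSpace (d + 1)) M] [IsManifold (𝓡∂ (d + 1)) ∞ M] (a b x : M) :
    Matrix (Fin (d + 1)) (Fin (d + 1)) ℝ :=
  Matrix.of fun j i => (tangentCoordChange (𝓡∂ (d + 1)) a b x
    (EuclideanSpace.single i (1 : ℝ) : EuclideanSpace ℝ (Fin (d + 1)))) j

lemma euclidean_eq_sum_single (v : EuclideanSpace ℝ (Fin (d + 1))) :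
    v = ∑ j, v j • (EuclideanSpace.single j (1 : ℝ) : EuclideanSpace ℝ (Fin (d + 1))) := by
  ext k
  simp [Finset.sum_apply, Pi.single_apply]

lemma tangentCoordChange_eq_sum (a b x : M) (i : Fin (d + 1)) :
    tangentCoordChange (𝓡∂ (d + 1)) a b x
      (EuclideanSpace.single i (1 : ℝ) : EuclideanSpace ℝ (Fin (d + 1)))
    = ∑ j, coordJacobian d a b x j i •
        (EuclideanSpace.single j (1 : ℝ) : EuclideanSpace ℝ (Fin (d + 1))) :=
  euclidean_eq_sum_single _

lemma chartFrame_eq_sum {a b x : M} (ha : x ∈ (extChartAt (𝓡∂ (d + 1)) a).source)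
    (hb : x ∈ (extChartAt (𝓡∂ (d + 1)) b).source) (i : Fin (d + 1)) :
    chartFrame a x i = ∑ j, coordJacobian d a b x j i • chartFrame b x j := by
  have h := tangentCoordChange_comp (I := 𝓡∂ (d + 1)) (w := a) (x := b) (y := x) (z := x)
    (v := (EuclideanSpace.single i (1 : ℝ) : EuclideanSpace ℝ (Fin (d + 1))))
    ⟨⟨ha, hb⟩, mem_extChartAt_source x⟩
  rw [tangentCoordChange_eq_sum a b, map_sum] at h
  simp only [map_smul] at h
  exact h.symm

lemma chartFrame_self (x : M) (i : Fin (d + 1)) : chartFrame x x i = frame x i :=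
  tangentCoordChange_self (I := 𝓡∂ (d + 1)) (mem_extChartAt_source x)

lemma coordJacobian_self {a x : M} (ha : x ∈ (extChartAt (𝓡∂ (d + 1)) a).source) :
    coordJacobian d a a x = 1 := by
  ext j i
  simp only [coordJacobian, Matrix.of_apply]
  rw [tangentCoordChange_self ha]
  simp [Matrix.one_apply]

lemma coordJacobian_mul {a b c x : M} (ha : x ∈ (extChartAt (𝓡∂ (d + 1)) a).source)
    (hb : x ∈ (extChartAt (𝓡∂ (d + 1)) b).source)
    (hc : x ∈ (extChartAt (𝓡∂ (d + 1)) c).source) :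
    coordJacobian d b c x * coordJacobian d a b x = coordJacobian d a c x := by
  ext k i
  have h := tangentCoordChange_comp (I := 𝓡∂ (d + 1)) (w := a) (x := b) (y := c) (z := x)
    (v := (EuclideanSpace.single i (1 : ℝ) : EuclideanSpace ℝ (Fin (d + 1)))) ⟨⟨ha, hb⟩, hc⟩
  rw [tangentCoordChange_eq_sum a b, map_sum] at h
  have h2 := congrArg (fun v : EuclideanSpace ℝ (Fin (d + 1)) => v k) h
  simp only [map_smul] at h2
  rw [Matrix.mul_apply]
  simp only [coordJacobian, Matrix.of_apply] at h2 ⊢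
  rw [← h2]
  simp only [WithLp.ofLp_sum, WithLp.ofLp_smul, Finset.sum_apply, Pi.smul_apply, smul_eq_mul]
  exact Finset.sum_congr rfl fun _ _ => mul_comm _ _

lemma coordJacobian_mul_cancel {a b x : M} (ha : x ∈ (extChartAt (𝓡∂ (d + 1)) a).source)
    (hb : x ∈ (extChartAt (𝓡∂ (d + 1)) b).source) :
    coordJacobian d b a x * coordJacobian d a b x = 1 := by
  rw [coordJacobian_mul ha hb ha, coordJacobian_self ha]

lemma det_coordJacobian (a b x : M) :
    (coordJacobian d a b x).det = (tangentCoordChange (𝓡∂ (d + 1)) a b x).det := by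
  change _ = LinearMap.det _
  rw [← LinearMap.det_toMatrix (EuclideanSpace.basisFun (Fin (d + 1)) ℝ).toBasis]
  congr 1

variable (g : Metric d M)

lemma chartGram_self (x : M) : chartGram g x x = gram g x := by
  ext i j
  simp [chartGram, gram, chartFrame_self]

lemma chartGram_eq {a b x : M} (ha : x ∈ (extChartAt (𝓡∂ (d + 1)) a).source)
    (hb : x ∈ (extChartAt (𝓡∂ (d + 1)) b).source) :
    chartGram g a x = (coordJacobian d a b x)ᵀ * chartGram g b x * coordJacobian d a b x := by
  ext i j
  simp only [chartGram, Matrix.of_apply, Matrix.mul_apply, Matrix.transpose_apply]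
  rw [chartFrame_eq_sum ha hb i, chartFrame_eq_sum ha hb j]
  simp only [map_sum, map_smul, sum_apply, smul_apply,
    smul_eq_mul, Finset.mul_sum, Finset.sum_mul]
  exact Finset.sum_congr rfl fun p _ => Finset.sum_congr rfl fun q _ => by ring

lemma gram_posDef (x : M) : (gram g x).PosDef := by
  refine Matrix.PosDef.of_dotProduct_mulVec_pos ?_ ?_
  · ext i j
    simp [gram, g.symm x (frame x i)]
  · intro v hv
    have h : star v ⬝ᵥ (gram g x *ᵥ v)
        = g.inner x (∑ i, v i • frame x i) (∑ i, v i • frame x i) := by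
      simp only [map_sum, map_smul, sum_apply, smul_apply,
        smul_eq_mul, dotProduct, Matrix.mulVec, gram, Matrix.of_apply, Finset.mul_sum, star_trivial]
      rw [Finset.sum_comm]
      exact Finset.sum_congr rfl fun p _ => Finset.sum_congr rfl fun q _ => by
        rw [g.symm x (frame x q)]; ring
    rw [h]
    refine g.pos x _ fun h0 => hv ?_
    ext i
    have := congrArg (fun w : EuclideanSpace ℝ (Fin (d + 1)) => w i)
      ((euclidean_eq_sum_single (WithLp.toLp 2 v)).trans h0)
    simp at this
    exact this

lemma chartGram_posDef {a x : M} (ha : x ∈ (extChartAt (𝓡∂ (d + 1)) a).source) :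
    (chartGram g a x).PosDef := by
  have hx := mem_extChartAt_source (I := 𝓡∂ (d + 1)) x
  rw [chartGram_eq g ha hx, chartGram_self]
  have := (gram_posDef g x).conjTranspose_mul_mul_same (B := coordJacobian d a x x) (by
    apply Matrix.mulVec_injective_of_isUnit
    exact IsUnit.of_mul_eq_one_right _ (coordJacobian_mul_cancel ha hx))
  simpa using this

lemma inv_chartGram_eq {a b x : M} (ha : x ∈ (extChartAt (𝓡∂ (d + 1)) a).source)
    (hb : x ∈ (extChartAt (𝓡∂ (d + 1)) b).source) :
    (chartGram g a x)⁻¹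
      = coordJacobian d b a x * (chartGram g b x)⁻¹ * (coordJacobian d b a x)ᵀ := by
  have h1 := coordJacobian_mul_cancel ha hb
  have h2 := (chartGram_posDef g hb).det_pos.ne'.isUnit
  have h3 : (coordJacobian d a b x) * coordJacobian d b a x = 1 := coordJacobian_mul_cancel hb ha
  rw [chartGram_eq g ha hb, Matrix.mul_inv_rev, Matrix.mul_inv_rev, Matrix.inv_eq_left_inv h1,
    ← Matrix.transpose_nonsing_inv, Matrix.inv_eq_left_inv h1, Matrix.mul_assoc]

/-- The expression `g^{ij} ⟨αᵢ, βⱼ⟩` computed in the coordinates of the preferred chart at `a`. -/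
def chartVecFormInner (a x : M) (α β : TangentSpace (𝓡∂ (d + 1)) x →L[ℝ] (Fin m → ℂ)) : ℂ :=
  ∑ i, ∑ j, ((chartGram g a x)⁻¹ i j : ℂ) * herm (α (chartFrame a x i)) (β (chartFrame a x j))

lemma herm_sum_smul (r s : Fin (d + 1) → ℝ) (u v : Fin (d + 1) → Fin m → ℂ) :
    herm (∑ i : Fin (d + 1), r i • u i) (∑ j : Fin (d + 1), s j • v j)
      = ∑ i, ∑ j, (r i : ℂ) * (s j : ℂ) * herm (u i) (v j) := by
  simp only [herm, Finset.sum_apply, Pi.smul_apply, Complex.real_smul, map_sum, map_mul,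
    Complex.conj_ofReal]
  simp only [Finset.sum_mul_sum]
  simp only [Finset.mul_sum]
  rw [Finset.sum_comm]
  refine Finset.sum_congr rfl fun i _ => ?_
  rw [Finset.sum_comm]
  exact Finset.sum_congr rfl fun j _ => Finset.sum_congr rfl fun k _ => by ring

lemma sum_mul_eq_trace (G S : Matrix (Fin (d + 1)) (Fin (d + 1)) ℂ) :
    ∑ i, ∑ j, G i j * S i j = (G * Sᵀ).trace := by
  simp [Matrix.trace, Matrix.mul_apply]

/-- The pairing of covectors does not depend on the chart used to compute it. -/
lemma vecFormInner_eq_chart {a x : M} (ha : x ∈ (extChartAt (𝓡∂ (d + 1)) a).source)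
    (α β : TangentSpace (𝓡∂ (d + 1)) x →L[ℝ] (Fin m → ℂ)) :
    vecFormInner g x α β = chartVecFormInner g a x α β := by
  have hx := mem_extChartAt_source (I := 𝓡∂ (d + 1)) x
  set S : Matrix (Fin (d + 1)) (Fin (d + 1)) ℂ :=
    Matrix.of fun i j => herm (α (chartFrame a x i)) (β (chartFrame a x j)) with hS
  set T : Matrix (Fin (d + 1)) (Fin (d + 1)) ℂ :=
    Matrix.of fun i j => herm (α (frame x i)) (β (frame x j)) with hT
  set P := (coordJacobian d x a x).map (fun r : ℝ => (r : ℂ)) with hP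
  set G := ((chartGram g a x)⁻¹).map (fun r : ℝ => (r : ℂ)) with hG
  have hPS : T = Pᵀ * S * P := by
    ext i j
    simp only [hT, hS, Matrix.of_apply, Matrix.mul_apply, Matrix.transpose_apply, hP,
      Matrix.map_apply]
    rw [← chartFrame_self x i, ← chartFrame_self x j, chartFrame_eq_sum hx ha i,
      chartFrame_eq_sum hx ha j]
    simp only [map_sum, map_smul]
    rw [herm_sum_smul, Finset.sum_comm]
    refine Finset.sum_congr rfl fun p _ => ?_
    rw [Finset.sum_mul]
    exact Finset.sum_congr rfl fun q _ => by ring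
  have hcoord : (coordJacobian d a x x) * coordJacobian d x a x = 1 :=
    coordJacobian_mul_cancel hx ha
  set R := (coordJacobian d a x x).map (fun r : ℝ => (r : ℂ)) with hR
  have hPR : P * R = 1 := by
    have : coordJacobian d x a x * coordJacobian d a x x = 1 := coordJacobian_mul_cancel ha hx
    have h2 := congrArg (fun A => Complex.ofRealHom.mapMatrix A) this
    simp only [map_mul, map_one] at h2
    exact h2
  have hGx : (invGram g x).map (fun r : ℝ => (r : ℂ)) = R * G * Rᵀ := by
    rw [invGram, ← chartGram_self, inv_chartGram_eq g hx ha]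
    change Complex.ofRealHom.mapMatrix _ = _
    simp only [map_mul]
    rfl
  calc vecFormInner g x α β
      = ∑ i, ∑ j, ((invGram g x).map (fun r : ℝ => (r : ℂ))) i j * T i j := rfl
    _ = ∑ i, ∑ j, G i j * S i j := by
        rw [sum_mul_eq_trace, sum_mul_eq_trace, hGx, hPS, Matrix.transpose_mul,
          Matrix.transpose_mul, Matrix.transpose_transpose]
        have hRP : Rᵀ * Pᵀ = 1 := by rw [← Matrix.transpose_mul, hPR, Matrix.transpose_one]
        rw [show R * G * Rᵀ * (Pᵀ * (Sᵀ * P)) = R * (G * ((Rᵀ * Pᵀ) * Sᵀ) * P) by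
          simp only [Matrix.mul_assoc], hRP, Matrix.trace_mul_comm, Matrix.mul_assoc, hPR,
          Matrix.one_mul, Matrix.mul_one]
    _ = chartVecFormInner g a x α β := rfl

end Frames

/-! ### Boundary points and the outward normal in a chart -/

section Boundary

variable {d m : ℕ} {M : Type*} [TopologicalSpace M]
  [ChartedSpace (EuclideanHalfSpace (d + 1)) M]

lemma extChartAt_zero_nonneg (a x : M) : 0 ≤ extChartAt (𝓡∂ (d + 1)) a x 0 := by
  have : extChartAt (𝓡∂ (d + 1)) a x ∈ range (𝓡∂ (d + 1)) := by
    rw [extChartAt_coe]; exact mem_range_self _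
  rw [range_modelWithCornersEuclideanHalfSpace] at this
  exact this

variable [IsManifold (𝓡∂ (d + 1)) ∞ M]

lemma mem_interior_iff_chart {a x : M} (ha : x ∈ (extChartAt (𝓡∂ (d + 1)) a).source) :
    x ∈ (𝓡∂ (d + 1)).interior M ↔ 0 < extChartAt (𝓡∂ (d + 1)) a x 0 := by
  rw [extChartAt_source] at ha
  have h := (𝓡∂ (d + 1)).isInteriorPoint_iff_of_mem_atlas (n := ∞) (by simp)
    (chart_mem_atlas (EuclideanHalfSpace (d + 1)) a) ha
  have h2 : (chartAt (EuclideanHalfSpace (d + 1)) a).extend (𝓡∂ (d + 1)) x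
      ∈ interior ((chartAt (EuclideanHalfSpace (d + 1)) a).extend (𝓡∂ (d + 1))).target ↔
      (chartAt (EuclideanHalfSpace (d + 1)) a).extend (𝓡∂ (d + 1)) x
        ∈ interior (range (𝓡∂ (d + 1))) :=
    ⟨fun h ↦ OpenPartialHomeomorph.interior_extend_target_subset_interior_range _ h,
      fun h ↦ OpenPartialHomeomorph.mem_interior_extend_target _
        ((chartAt (EuclideanHalfSpace (d + 1)) a).map_source ha) h⟩
  rw [h2, interior_range_modelWithCornersEuclideanHalfSpace] at h
  exact h

lemma mem_boundary_iff_chart {a x : M} (ha : x ∈ (extChartAt (𝓡∂ (d + 1)) a).source) :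
    x ∈ (𝓡∂ (d + 1)).boundary M ↔ extChartAt (𝓡∂ (d + 1)) a x 0 = 0 := by
  rw [← (𝓡∂ (d + 1)).compl_interior, mem_compl_iff, mem_interior_iff_chart ha, not_lt]
  exact ⟨fun h => le_antisymm h (extChartAt_zero_nonneg a x), fun h => h.le⟩

/-- A transition map sends the half space to itself, so at a boundary point its component normal
to the boundary has a minimum; hence the derivative of this component is nonnegative in every
direction that points into the half space. -/
lemma coordJacobian_nonneg_of_boundary {a b x : M}
    (ha : x ∈ (extChartAt (𝓡∂ (d + 1)) a).source) (hb : x ∈ (extChartAt (𝓡∂ (d + 1)) b).source)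
    (hx : x ∈ (𝓡∂ (d + 1)).boundary M) (v : EuclideanSpace ℝ (Fin (d + 1))) (hv : 0 ≤ v 0) :
    0 ≤ tangentCoordChange (𝓡∂ (d + 1)) a b x v 0 := by
  have hd := hasFDerivWithinAt_tangentCoordChange (I := 𝓡∂ (d + 1)) (x := a) (y := b) ⟨ha, hb⟩
  have hd0 : HasFDerivWithinAt
      (fun y => (extChartAt (𝓡∂ (d + 1)) b ((extChartAt (𝓡∂ (d + 1)) a).symm y)) 0)
      ((EuclideanSpace.proj (𝕜 := ℝ) (0 : Fin (d + 1))).comp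
        (tangentCoordChange (𝓡∂ (d + 1)) a b x)) (range (𝓡∂ (d + 1)))
      (extChartAt (𝓡∂ (d + 1)) a x) :=
    (EuclideanSpace.proj (𝕜 := ℝ) (0 : Fin (d + 1))).hasFDerivAt.comp_hasFDerivWithinAt _ hd
  have hmin : IsLocalMinOn
      (fun y => (extChartAt (𝓡∂ (d + 1)) b ((extChartAt (𝓡∂ (d + 1)) a).symm y)) 0)
      (range (𝓡∂ (d + 1))) (extChartAt (𝓡∂ (d + 1)) a x) := by
    refine Filter.Eventually.of_forall fun y => ?_
    simp only [(extChartAt (𝓡∂ (d + 1)) a).left_inv ha, (mem_boundary_iff_chart hb).1 hx]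
    exact extChartAt_zero_nonneg b _
  refine hmin.hasFDerivWithinAt_nonneg hd0 (mem_posTangentConeAt_of_segment_subset ?_)
  rw [range_modelWithCornersEuclideanHalfSpace]
  intro y hy
  rw [segment_eq_image'] at hy
  obtain ⟨t, ht, rfl⟩ := hy
  have h0 := (mem_boundary_iff_chart ha).1 hx
  simp only [mem_ofPred_eq, PiLp.add_apply, PiLp.smul_apply, h0, add_sub_cancel_left, smul_eq_mul]
  have := mul_nonneg ht.1 hv
  linarith

lemma coordJacobian_zero_eq_zero {a b x : M}
    (ha : x ∈ (extChartAt (𝓡∂ (d + 1)) a).source) (hb : x ∈ (extChartAt (𝓡∂ (d + 1)) b).source)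
    (hx : x ∈ (𝓡∂ (d + 1)).boundary M) {l : Fin (d + 1)} (hl : l ≠ 0) :
    coordJacobian d a b x 0 l = 0 := by
  have h1 := coordJacobian_nonneg_of_boundary ha hb hx
    (EuclideanSpace.single l (1 : ℝ)) (by simp [hl.symm])
  have h2 := coordJacobian_nonneg_of_boundary ha hb hx
    (-EuclideanSpace.single l (1 : ℝ)) (by simp [hl.symm])
  rw [map_neg] at h2
  simp only [PiLp.neg_apply] at h2
  simp only [coordJacobian, Matrix.of_apply]
  linarith

lemma coordJacobian_zero_zero_pos {a b x : M}
    (ha : x ∈ (extChartAt (𝓡∂ (d + 1)) a).source) (hb : x ∈ (extChartAt (𝓡∂ (d + 1)) b).source)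
    (hx : x ∈ (𝓡∂ (d + 1)).boundary M) : 0 < coordJacobian d a b x 0 0 := by
  have h1 : 0 ≤ coordJacobian d a b x 0 0 := coordJacobian_nonneg_of_boundary ha hb hx
    (EuclideanSpace.single 0 (1 : ℝ)) (by simp)
  refine lt_of_le_of_ne h1 fun h0 => ?_
  have h := congrFun (congrFun (coordJacobian_mul_cancel hb ha) 0) 0
  rw [Matrix.mul_apply, Fin.sum_univ_succ, ← h0] at h
  simp [coordJacobian_zero_eq_zero ha hb hx (Fin.succ_ne_zero _)] at h

variable (g : Metric d M)

/-- The defining formula of the outward normal holds in every chart around a boundary point,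
because `dy₀` of two charts differ there by a positive factor. -/
lemma outwardNormal_eq_chart {a x : M} (ha : x ∈ (extChartAt (𝓡∂ (d + 1)) a).source)
    (hx : x ∈ (𝓡∂ (d + 1)).boundary M) :
    outwardNormal g x = ∑ i, (-((chartGram g a x)⁻¹ i 0) / Real.sqrt ((chartGram g a x)⁻¹ 0 0)) •
      chartFrame a x i := by
  have hxx := mem_extChartAt_source (I := 𝓡∂ (d + 1)) x
  set c := coordJacobian d a x x 0 0 with hc
  have hcpos : 0 < c := coordJacobian_zero_zero_pos ha hxx hx
  have h0 : ∀ l, coordJacobian d a x x 0 l = if l = 0 then c else 0 := by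
    intro l
    split_ifs with h
    · rw [h]
    · exact coordJacobian_zero_eq_zero ha hxx hx h
  have hcol : ∀ i, invGram g x i 0
      = ∑ k, coordJacobian d a x x i k * ((chartGram g a x)⁻¹ k 0 * c) := by
    intro i
    rw [invGram, ← chartGram_self, inv_chartGram_eq g hxx ha, Matrix.mul_assoc, Matrix.mul_apply]
    refine Finset.sum_congr rfl fun k _ => ?_
    simp [Matrix.mul_apply, h0]
  have h00 : invGram g x 0 0 = c ^ 2 * (chartGram g a x)⁻¹ 0 0 := by
    rw [hcol]
    simp only [h0, ite_mul, zero_mul, Finset.sum_ite_eq', Finset.mem_univ, if_true]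
    ring
  have hs : Real.sqrt (invGram g x 0 0) = c * Real.sqrt ((chartGram g a x)⁻¹ 0 0) := by
    rw [h00, Real.sqrt_mul (sq_nonneg c), Real.sqrt_sq hcpos.le]
  rw [outwardNormal, hs]
  simp only [hcol]
  have hF : ∀ i, chartFrame a x i = ∑ j, coordJacobian d a x x j i • frame x j := fun i => by
    rw [chartFrame_eq_sum ha hxx]; simp only [chartFrame_self]
  simp only [hF, Finset.smul_sum, smul_smul]
  rw [Finset.sum_comm]
  refine Finset.sum_congr rfl fun j _ => ?_
  rw [← Finset.sum_smul]
  congr 1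
  rw [← Finset.sum_neg_distrib, Finset.sum_div]
  refine Finset.sum_congr rfl fun k _ => ?_
  rw [show -(coordJacobian d a x x j k * ((chartGram g a x)⁻¹ k 0 * c))
    = c * (-(chartGram g a x)⁻¹ k 0 * coordJacobian d a x x j k) by ring,
    mul_div_mul_left _ _ hcpos.ne']
  ring

end Boundary

/-- Cramer's rule: `g^{00} det g` is the minor of `g_{00}`, so `√(det g) √(g^{00})` is the density of
the surface measure. -/
lemma sqrt_det_mul_sqrt_inv {d : ℕ} {G : Matrix (Fin (d + 1)) (Fin (d + 1)) ℝ} (hG : G.PosDef) :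
    Real.sqrt G.det * Real.sqrt (G⁻¹ 0 0)
      = Real.sqrt (G.submatrix Fin.succ Fin.succ).det := by
  rw [← Real.sqrt_mul hG.det_pos.le]
  congr 1
  rw [Matrix.inv_def, Matrix.smul_apply, Matrix.adjugate_fin_succ_eq_det_submatrix,
    Ring.inverse_eq_inv', smul_eq_mul, ← mul_assoc, mul_inv_cancel₀ hG.det_pos.ne']
  simp [Fin.succAbove_zero]

/-! ### Continuity of tensors in chart frames -/

section Continuity

variable {d m : ℕ} {M : Type*} [TopologicalSpace M]
  [ChartedSpace (EuclideanHalfSpace (d + 1)) M] [IsManifold (𝓡∂ (d + 1)) ∞ M]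

lemma contMDiffOn_chartFrame (a : M) (i : Fin (d + 1)) :
    ContMDiffOn (𝓡∂ (d + 1)) ((𝓡∂ (d + 1)).prod 𝓘(ℝ, EuclideanSpace ℝ (Fin (d + 1)))) ∞
      (fun x : M => TotalSpace.mk' (EuclideanSpace ℝ (Fin (d + 1)))
        (E := fun x : M => TangentSpace (𝓡∂ (d + 1)) x) x (chartFrame a x i))
      (extChartAt (𝓡∂ (d + 1)) a).source := by
  rw [extChartAt_source]
  have h := (trivializationAt (EuclideanSpace ℝ (Fin (d + 1)))
    (fun x : M => TangentSpace (𝓡∂ (d + 1)) x) a).contMDiffOn_localFrame_baseSet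
    (I := 𝓡∂ (d + 1)) ∞ (EuclideanSpace.basisFun (Fin (d + 1)) ℝ).toBasis i
  refine h.congr fun x hx => ?_
  congr 1
  rw [Trivialization.localFrame_apply_of_mem_baseSet _ _ hx]
  have h2 := DFunLike.congr_fun (TangentBundle.symmL_trivializationAt_eq_core
    (I := 𝓡∂ (d + 1)) hx) (EuclideanSpace.single i (1 : ℝ))
  rw [Trivialization.symmL_apply _ hx] at h2
  simp only [Trivialization.basisAt, Module.Basis.map_apply, OrthonormalBasis.coe_toBasis,
    EuclideanSpace.basisFun_apply, Trivialization.linearEquivAt_symm_apply]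
  exact h2.symm

lemma continuousOn_chartFrame_apply {F : Type*} [NormedAddCommGroup F] [NormedSpace ℝ F]
    (η : ∀ x : M, TangentSpace (𝓡∂ (d + 1)) x →L[ℝ] F)
    (hη : ContMDiff (𝓡∂ (d + 1))
    ((𝓡∂ (d + 1)).prod 𝓘(ℝ, EuclideanSpace ℝ (Fin (d + 1)) →L[ℝ] F)) ∞
    (fun x : M => TotalSpace.mk' (EuclideanSpace ℝ (Fin (d + 1)) →L[ℝ] F)
      (E := fun x : M => TangentSpace (𝓡∂ (d + 1)) x →L[ℝ] Bundle.Trivial M F x) x (η x)))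
    (a : M) (i : Fin (d + 1)) :
    ContinuousOn (fun x => η x (chartFrame a x i)) (extChartAt (𝓡∂ (d + 1)) a).source := by
  intro x hx
  have h := (hη.contMDiffOn.clm_bundle_apply (contMDiffOn_chartFrame a i)) x hx
  simp only [contMDiffWithinAt_totalSpace] at h
  exact h.2.continuousWithinAt

lemma continuousOn_mfderiv_chartFrame {F : Type*} [NormedAddCommGroup F] [NormedSpace ℝ F]
    {u : M → F} (hu : ContMDiff (𝓡∂ (d + 1)) 𝓘(ℝ, F) ∞ u) (a : M) (i : Fin (d + 1)) :
    ContinuousOn (fun x => (mfderiv (𝓡∂ (d + 1)) 𝓘(ℝ, F) u x (chartFrame a x i) : F))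
      (extChartAt (𝓡∂ (d + 1)) a).source := by
  have h1 := (hu.contMDiff_tangentMap (m := 0) (by simp)).continuous
  have h2 := h1.comp_continuousOn (contMDiffOn_chartFrame a i).continuousOn
  have h3 := (tangentBundleModelSpaceHomeomorph 𝓘(ℝ, F)).continuous.comp_continuousOn h2
  exact continuous_snd.comp_continuousOn h3

lemma continuousOn_chartGram (g : Metric d M) (a : M) :
    ContinuousOn (fun x => chartGram g a x) (extChartAt (𝓡∂ (d + 1)) a).source := by
  refine continuousOn_pi.2 fun i => continuousOn_pi.2 fun j => ?_
  intro x hx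
  have h : ContMDiffWithinAt (𝓡∂ (d + 1)) ((𝓡∂ (d + 1)).prod 𝓘(ℝ)) ∞
      (fun x : M ↦ TotalSpace.mk' ℝ (E := Bundle.Trivial M ℝ) x
        (g.inner x (chartFrame a x i) (chartFrame a x j)))
      (extChartAt (𝓡∂ (d + 1)) a).source x := by
    apply ContMDiffWithinAt.clm_bundle_apply₂ (F₁ := EuclideanSpace ℝ (Fin (d + 1)))
      (F₂ := EuclideanSpace ℝ (Fin (d + 1)))
    · exact g.contMDiff.contMDiffAt.contMDiffWithinAt
    · exact contMDiffOn_chartFrame a i x hx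
    · exact contMDiffOn_chartFrame a j x hx
  simp only [contMDiffWithinAt_totalSpace] at h
  exact h.2.continuousWithinAt

end Continuity

/-! ### The volume measure in a chart -/

section Volume

variable {d m : ℕ} {M : Type*} [TopologicalSpace M]
  [ChartedSpace (EuclideanHalfSpace (d + 1)) M]

lemma measurableSet_extChartAt_target (a : M) :
    MeasurableSet (extChartAt (𝓡∂ (d + 1)) a).target := by
  rw [extChartAt_target]
  exact (((chartAt (EuclideanHalfSpace (d + 1)) a).open_target.preimage
    (𝓡∂ (d + 1)).continuous_symm).measurableSet).inter (𝓡∂ (d + 1)).isClosed_range.measurableSet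

lemma measurableSet_target_inter_preimage (a : M) {s : Set M} (hs : IsOpen s) :
    MeasurableSet ((extChartAt (𝓡∂ (d + 1)) a).target ∩
      (extChartAt (𝓡∂ (d + 1)) a).symm ⁻¹' s) := by
  obtain ⟨U, hU, h⟩ := continuousOn_iff'.1 (continuousOn_extChartAt_symm (I := 𝓡∂ (d + 1)) a) s hs
  rw [inter_comm, h, inter_comm]
  exact (measurableSet_extChartAt_target a).inter hU.measurableSet

lemma aemeasurable_extChartAt_symm [MeasurableSpace M] [BorelSpace M] (a : M) :
    AEMeasurable (extChartAt (𝓡∂ (d + 1)) a).symm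
      ((volume : Measure (EuclideanSpace ℝ (Fin (d + 1)))).restrict
        (extChartAt (𝓡∂ (d + 1)) a).target) :=
  (continuousOn_extChartAt_symm a).aemeasurable (measurableSet_extChartAt_target a)

variable [IsManifold (𝓡∂ (d + 1)) ∞ M] (g : Metric d M)

lemma continuousOn_sqrt_det_chartGram (a : M) :
    ContinuousOn (fun x => Real.sqrt (chartGram g a x).det)
      (extChartAt (𝓡∂ (d + 1)) a).source :=
  Real.continuous_sqrt.comp_continuousOn
    (Continuous.matrix_det continuous_id |>.comp_continuousOn (continuousOn_chartGram g a))

lemma continuousOn_density (a : M) :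
    ContinuousOn (fun y => Real.sqrt (chartGram g a ((extChartAt (𝓡∂ (d + 1)) a).symm y)).det)
      (extChartAt (𝓡∂ (d + 1)) a).target :=
  (continuousOn_sqrt_det_chartGram g a).comp (continuousOn_extChartAt_symm a)
    (extChartAt (𝓡∂ (d + 1)) a).mapsTo_symm

lemma aemeasurable_density (a : M) :
    AEMeasurable (fun y => ENNReal.ofReal
      (Real.sqrt (chartGram g a ((extChartAt (𝓡∂ (d + 1)) a).symm y)).det))
      ((volume : Measure (EuclideanSpace ℝ (Fin (d + 1)))).restrict
        (extChartAt (𝓡∂ (d + 1)) a).target) :=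
  ((continuousOn_density g a).aemeasurable (measurableSet_extChartAt_target a)).ennreal_ofReal

variable [MeasurableSpace M] [BorelSpace M]

lemma lintegral_chartVolume (a : M) {f : M → ENNReal} (hf : Measurable f) :
    ∫⁻ x, f x ∂(chartVolume g a) = ∫⁻ y in (extChartAt (𝓡∂ (d + 1)) a).target,
      ENNReal.ofReal (Real.sqrt (chartGram g a ((extChartAt (𝓡∂ (d + 1)) a).symm y)).det)
        * f ((extChartAt (𝓡∂ (d + 1)) a).symm y) := by
  rw [chartVolume, lintegral_map' hf.aemeasurable
    ((aemeasurable_extChartAt_symm a).mono_ac (withDensity_absolutelyContinuous _ _)),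
    ← Function.comp_def f, lintegral_withDensity_eq_lintegral_mul₀ (aemeasurable_density g a)
      (hf.comp_aemeasurable (aemeasurable_extChartAt_symm a))]
  rfl

/-- On the overlap of two charts both measures `√(det g_{ij}) dy` agree, by the change of
variables formula. -/
lemma chartVolume_restrict_source (a b : M) :
    (chartVolume g b).restrict (extChartAt (𝓡∂ (d + 1)) a).source
      = (chartVolume g a).restrict (extChartAt (𝓡∂ (d + 1)) b).source := by
  have hoa := isOpen_extChartAt_source (I := 𝓡∂ (d + 1)) a
  have hob := isOpen_extChartAt_source (I := 𝓡∂ (d + 1)) b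
  refine Measure.ext_of_lintegral _ fun f hf => ?_
  have key : ∀ p q : M, ∫⁻ x, f x ∂(chartVolume g p).restrict (extChartAt (𝓡∂ (d + 1)) q).source
      = ∫⁻ y in (extChartAt (𝓡∂ (d + 1)) p).target ∩
          (extChartAt (𝓡∂ (d + 1)) p).symm ⁻¹' (extChartAt (𝓡∂ (d + 1)) q).source,
        ENNReal.ofReal (Real.sqrt (chartGram g p ((extChartAt (𝓡∂ (d + 1)) p).symm y)).det)
          * f ((extChartAt (𝓡∂ (d + 1)) p).symm y) := by
    intro p q
    have hq := isOpen_extChartAt_source (I := 𝓡∂ (d + 1)) q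
    have hm := measurableSet_target_inter_preimage (d := d) p hq
    rw [← lintegral_indicator hq.measurableSet,
      lintegral_chartVolume g p (hf.indicator hq.measurableSet),
      ← lintegral_indicator (measurableSet_extChartAt_target p), ← lintegral_indicator hm]
    refine lintegral_congr fun y => ?_
    by_cases h1 : y ∈ (extChartAt (𝓡∂ (d + 1)) p).target
    · by_cases h2 : (extChartAt (𝓡∂ (d + 1)) p).symm y ∈ (extChartAt (𝓡∂ (d + 1)) q).source
      · rw [indicator_of_mem h1, indicator_of_mem h2, indicator_of_mem (mem_inter h1 h2)]
      · rw [indicator_of_mem h1, indicator_of_notMem h2, mul_zero,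
          indicator_of_notMem fun h => h2 h.2]
    · rw [indicator_of_notMem h1, indicator_of_notMem fun h => h1 h.1]
  rw [key, key]
  set Ta := (extChartAt (𝓡∂ (d + 1)) a).target ∩
    (extChartAt (𝓡∂ (d + 1)) a).symm ⁻¹' (extChartAt (𝓡∂ (d + 1)) b).source with hTa
  have hImage : (extChartAt (𝓡∂ (d + 1)) b).target ∩
      (extChartAt (𝓡∂ (d + 1)) b).symm ⁻¹' (extChartAt (𝓡∂ (d + 1)) a).source
      = (extChartAt (𝓡∂ (d + 1)) b ∘ (extChartAt (𝓡∂ (d + 1)) a).symm) '' Ta := by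
    ext y
    constructor
    · rintro ⟨h1, h2⟩
      refine ⟨extChartAt (𝓡∂ (d + 1)) a ((extChartAt (𝓡∂ (d + 1)) b).symm y),
        ⟨(extChartAt (𝓡∂ (d + 1)) a).map_source h2, ?_⟩, ?_⟩
      · rw [mem_preimage, (extChartAt (𝓡∂ (d + 1)) a).left_inv h2]
        exact (extChartAt (𝓡∂ (d + 1)) b).map_target h1
      · rw [Function.comp_apply, (extChartAt (𝓡∂ (d + 1)) a).left_inv h2,
          (extChartAt (𝓡∂ (d + 1)) b).right_inv h1]
    · rintro ⟨z, ⟨h1, h2⟩, rfl⟩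
      refine ⟨(extChartAt (𝓡∂ (d + 1)) b).map_source h2, ?_⟩
      rw [mem_preimage, Function.comp_apply, (extChartAt (𝓡∂ (d + 1)) b).left_inv h2]
      exact (extChartAt (𝓡∂ (d + 1)) a).map_target h1
  have hder : ∀ y ∈ Ta, HasFDerivWithinAt
      (extChartAt (𝓡∂ (d + 1)) b ∘ (extChartAt (𝓡∂ (d + 1)) a).symm)
      (tangentCoordChange (𝓡∂ (d + 1)) a b ((extChartAt (𝓡∂ (d + 1)) a).symm y)) Ta y := by
    rintro y ⟨h1, h2⟩
    have := hasFDerivWithinAt_tangentCoordChange (I := 𝓡∂ (d + 1)) (x := a) (y := b)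
      ⟨(extChartAt (𝓡∂ (d + 1)) a).map_target h1, h2⟩
    rw [(extChartAt (𝓡∂ (d + 1)) a).right_inv h1] at this
    exact this.mono fun z hz => extChartAt_target_subset_range a hz.1
  have hinj : InjOn (extChartAt (𝓡∂ (d + 1)) b ∘ (extChartAt (𝓡∂ (d + 1)) a).symm) Ta := by
    rintro y ⟨h1, h2⟩ z ⟨h3, h4⟩ h
    exact (extChartAt (𝓡∂ (d + 1)) a).symm.injOn h1 h3
      ((extChartAt (𝓡∂ (d + 1)) b).injOn h2 h4 h)
  have hmeas : MeasurableSet Ta := measurableSet_target_inter_preimage a hob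
  rw [hImage, lintegral_image_eq_lintegral_abs_det_fderiv_mul volume hmeas hder hinj]
  refine setLIntegral_congr_fun hmeas fun y hy => ?_
  have hya := (extChartAt (𝓡∂ (d + 1)) a).map_target hy.1
  simp only [Function.comp_apply, (extChartAt (𝓡∂ (d + 1)) b).left_inv hy.2]
  rw [← mul_assoc, ← ENNReal.ofReal_mul (abs_nonneg _), chartGram_eq g hya hy.2,
    Matrix.det_mul, Matrix.det_mul, Matrix.det_transpose, det_coordJacobian]
  congr 2
  rw [mul_right_comm, ← sq, Real.sqrt_mul (sq_nonneg _), Real.sqrt_sq_eq_abs]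

end Volume

/-! ### The partition of unity -/

section Partition

variable {d m : ℕ} {M : Type*} [TopologicalSpace M]
  [ChartedSpace (EuclideanHalfSpace (d + 1)) M] [IsManifold (𝓡∂ (d + 1)) ∞ M] [T2Space M]

lemma tsupport_chartPartition_subset [SigmaCompactSpace M] (a : M) :
    tsupport (chartPartition d M a) ⊆ (extChartAt (𝓡∂ (d + 1)) a).source := by
  rw [extChartAt_source]
  exact (SmoothPartitionOfUnity.exists_isSubordinate_chartAt_source (𝓡∂ (d + 1)) M).choose_spec a

lemma measurable_chartPartition [SigmaCompactSpace M] [MeasurableSpace M] [BorelSpace M] (a : M) :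
    Measurable fun x => ENNReal.ofReal (chartPartition d M a x) :=
  ((chartPartition d M a).contMDiff.continuous.measurable).ennreal_ofReal

variable [CompactSpace M]

variable (d M) in
/-- Only finitely many members of the partition of unity do not vanish identically. -/
lemma finite_chartPartition_support :
    {a : M | (Function.support (chartPartition d M a)).Nonempty}.Finite :=
  (chartPartition d M).locallyFinite.finite_nonempty_of_compact

lemma chartPartition_eq_zero {a : M}
    (ha : a ∉ (finite_chartPartition_support d M).toFinset) (x : M) :
    chartPartition d M a x = 0 := by
  by_contra h
  exact ha ((finite_chartPartition_support d M).mem_toFinset.2 ⟨x, h⟩)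

lemma sum_chartPartition (x : M) :
    ∑ a ∈ (finite_chartPartition_support d M).toFinset, chartPartition d M a x = 1 := by
  rw [← (chartPartition d M).sum_eq_one (mem_univ x), finsum_eq_sum_of_support_subset]
  intro a ha
  by_contra h
  exact ha (chartPartition_eq_zero (fun h' => h h') x)

variable (d M) in
lemma finite_indices_sum [MeasurableSpace M] (μ : M → Measure M) :
    (Measure.sum fun a : M =>
      (μ a).withDensity (fun x => ENNReal.ofReal (chartPartition d M a x)))
    = ∑ a ∈ (finite_chartPartition_support d M).toFinset,
      (μ a).withDensity (fun x => ENNReal.ofReal (chartPartition d M a x)) := by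
  ext s hs
  rw [Measure.sum_apply _ hs, Measure.finsetSum_apply, tsum_eq_sum]
  intro b hb
  simp [chartPartition_eq_zero hb]

variable [MeasurableSpace M] [BorelSpace M] (g : Metric d M)

/-- In the domain of a chart, `dV` is the measure `√(det g) dy` of that chart, irrespective of the
partition of unity. -/
lemma volumeMeasure_restrict_source (a : M) :
    (volumeMeasure g).restrict (extChartAt (𝓡∂ (d + 1)) a).source = chartVolume g a := by
  have hoa := (isOpen_extChartAt_source (I := 𝓡∂ (d + 1)) a).measurableSet
  refine Measure.ext_of_lintegral _ fun f hf => ?_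
  rw [volumeMeasure, Measure.restrict_sum _ hoa, lintegral_sum_measure]
  have h1 : ∀ b : M, ∫⁻ x, f x ∂(((chartVolume g b).withDensity
        (fun x => ENNReal.ofReal (chartPartition d M b x))).restrict
          (extChartAt (𝓡∂ (d + 1)) a).source)
      = ∫⁻ x, ENNReal.ofReal (chartPartition d M b x) * f x ∂(chartVolume g a) := by
    intro b
    have hob := (isOpen_extChartAt_source (I := 𝓡∂ (d + 1)) b).measurableSet
    rw [restrict_withDensity hoa, chartVolume_restrict_source,
      lintegral_withDensity_eq_lintegral_mul _ (measurable_chartPartition b) hf,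
      ← lintegral_indicator hob]
    refine lintegral_congr fun x => ?_
    by_cases hx : x ∈ (extChartAt (𝓡∂ (d + 1)) b).source
    · rw [indicator_of_mem hx, Pi.mul_apply]
    · have : chartPartition d M b x = 0 := by
        by_contra h
        exact hx (tsupport_chartPartition_subset b (subset_tsupport _ h))
      rw [indicator_of_notMem hx, this, ENNReal.ofReal_zero, zero_mul]
  simp only [h1]
  rw [tsum_eq_sum (s := (finite_chartPartition_support d M).toFinset)]
  · rw [← lintegral_finsetSum (f := fun b x => ENNReal.ofReal (chartPartition d M b x) * f x) _
      fun b _ => (measurable_chartPartition b).mul hf]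
    refine lintegral_congr fun x => ?_
    rw [← Finset.sum_mul, ← ENNReal.ofReal_sum_of_nonneg
      fun b _ => (chartPartition d M).nonneg b x, sum_chartPartition]
    simp
  · intro b hb
    simp [chartPartition_eq_zero hb]

end Partition

/-! ### Measures transported by a chart -/

section Transport

variable {X M : Type*} [MeasurableSpace X] [MeasurableSpace M]
  {μ : Measure X} {T : Set X} {D : X → ℝ} {ι : X → M}

lemma map_withDensity_eq_zero (hT : MeasurableSet T)
    (hι : AEMeasurable ι (μ.restrict T)) {B : Set M} (hB : MeasurableSet B) (hTB : MapsTo ι T B) :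
    (((μ.restrict T).withDensity fun y => ENNReal.ofReal (D y)).map ι) Bᶜ = 0 := by
  rw [Measure.map_apply_of_aemeasurable
    (hι.mono_ac (withDensity_absolutelyContinuous _ _)) hB.compl]
  refine withDensity_absolutelyContinuous _ _ ?_
  rw [Measure.restrict_apply_eq_zero' hT]
  convert measure_empty (μ := μ)
  ext y
  simp only [mem_inter_iff, mem_preimage, mem_compl_iff, mem_empty_iff_false, iff_false, not_and]
  exact fun h1 h2 => h1 (hTB h2)

variable [TopologicalSpace X] [BorelSpace X]

lemma integral_map_withDensity (hT : MeasurableSet T) (hD : ContinuousOn D T) (hD0 : ∀ y, 0 ≤ D y)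
    (hι : AEMeasurable ι (μ.restrict T)) {F : M → ℂ}
    (hF : AEStronglyMeasurable F
      (((μ.restrict T).withDensity fun y => ENNReal.ofReal (D y)).map ι)) :
    ∫ x, F x ∂(((μ.restrict T).withDensity fun y => ENNReal.ofReal (D y)).map ι)
      = ∫ y in T, (D y : ℂ) * F (ι y) ∂μ := by
  rw [integral_map (hι.mono_ac (withDensity_absolutelyContinuous _ _)) hF,
    integral_withDensity_eq_integral_toReal_smul₀ (hD.aemeasurable hT).ennreal_ofReal
      (by simp)]
  refine integral_congr_ae (Filter.Eventually.of_forall fun y => ?_)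
  simp [ENNReal.toReal_ofReal (hD0 y)]

lemma map_withDensity_lt_top [IsFiniteMeasureOnCompacts μ] [T2Space X] (hD : ContinuousOn D T)
    (hι : AEMeasurable ι (μ.restrict T)) {K : Set M} (hK : MeasurableSet K)
    (hc : IsCompact (T ∩ ι ⁻¹' K)) :
    (((μ.restrict T).withDensity fun y => ENNReal.ofReal (D y)).map ι) K < ⊤ := by
  rw [Measure.map_apply_of_aemeasurable
    (hι.mono_ac (withDensity_absolutelyContinuous _ _)) hK]
  have h1 := (hD.mono (inter_subset_left (t := ι ⁻¹' K))).integrableOn_compact (μ := μ) hc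
  have h2 := hι.nullMeasurableSet_preimage hK
  rw [withDensity_apply₀ _ h2, Measure.restrict_restrict₀ h2, inter_comm]
  exact h1.lintegral_lt_top

variable {M : Type*} [TopologicalSpace M] [MeasurableSpace M] [BorelSpace M]

lemma integrable_of_continuousOn_compact [T2Space M] {μ : Measure M} {F : M → ℂ} {K U : Set M}
    (hK : IsCompact K) (hKU : K ⊆ U) (hF : ContinuousOn F U) (hs : Function.support F ⊆ K)
    (hμ : μ K < ⊤) : Integrable F μ := by
  rw [← integrableOn_iff_integrable_of_support_subset hs]
  obtain ⟨C, hC⟩ := hK.exists_bound_of_continuousOn (hF.mono hKU)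
  have : IsFiniteMeasure (μ.restrict K) := ⟨by simpa using hμ⟩
  exact Integrable.of_bound ((hF.mono hKU).aestronglyMeasurable hK.measurableSet) C
    (ae_restrict_of_forall_mem hK.measurableSet hC)

lemma aestronglyMeasurable_of_continuousOn {μ : Measure M} {F : M → ℂ} {U : Set M}
    (hU : IsOpen U) (hF : ContinuousOn F U) (hμ : μ Uᶜ = 0) : AEStronglyMeasurable F μ := by
  rw [← Measure.restrict_eq_self_of_ae_mem (s := U) (μ := μ) (mem_ae_iff.2 hμ)]
  exact hF.aestronglyMeasurable hU.measurableSet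

end Transport

/-! ### Integrals against the volume and surface measures -/

section ChartMeasures

variable {d : ℕ} {M : Type*} [TopologicalSpace M]
  [ChartedSpace (EuclideanHalfSpace (d + 1)) M]

lemma continuous_boundaryIncl : Continuous (boundaryIncl (d := d)) := by
  refine (PiLp.continuous_toLp 2 _).comp (continuous_pi fun i => ?_)
  refine Fin.cases ?_ (fun j => ?_) i
  · simpa using continuous_const
  · simp only [Fin.cons_succ]
    fun_prop

lemma boundaryIncl_zero (z : EuclideanSpace ℝ (Fin d)) : boundaryIncl z 0 = 0 := rfl

/-- The points of `ℝ^d` that parametrize the boundary part of the preferred chart at `a`. -/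
def boundaryTarget (d : ℕ) {M : Type*} [TopologicalSpace M]
    [ChartedSpace (EuclideanHalfSpace (d + 1)) M] (a : M) : Set (EuclideanSpace ℝ (Fin d)) :=
  {z | boundaryIncl z ∈ (extChartAt (𝓡∂ (d + 1)) a).target}

lemma measurableSet_boundaryTarget (a : M) : MeasurableSet (boundaryTarget d a) :=
  continuous_boundaryIncl.measurable (measurableSet_extChartAt_target a)

lemma continuousOn_boundary_symm (a : M) :
    ContinuousOn (fun z => (extChartAt (𝓡∂ (d + 1)) a).symm (boundaryIncl z))
      (boundaryTarget d a) :=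
  (continuousOn_extChartAt_symm a).comp continuous_boundaryIncl.continuousOn fun _ h => h

lemma aemeasurable_boundary_symm [MeasurableSpace M] [BorelSpace M] (a : M) :
    AEMeasurable (fun z => (extChartAt (𝓡∂ (d + 1)) a).symm (boundaryIncl z))
      ((volume : Measure (EuclideanSpace ℝ (Fin d))).restrict (boundaryTarget d a)) :=
  (continuousOn_boundary_symm a).aemeasurable (measurableSet_boundaryTarget a)

lemma isCompact_target_inter_preimage (a : M) {K : Set M} (hK : IsCompact K)
    (hKa : K ⊆ (extChartAt (𝓡∂ (d + 1)) a).source) :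
    IsCompact ((extChartAt (𝓡∂ (d + 1)) a).target ∩ (extChartAt (𝓡∂ (d + 1)) a).symm ⁻¹' K) := by
  rw [← (extChartAt (𝓡∂ (d + 1)) a).image_eq_target_inter_inv_preimage hKa]
  exact hK.image_of_continuousOn ((continuousOn_extChartAt a).mono hKa)

lemma isCompact_boundaryTarget_inter_preimage (a : M) {K : Set M} (hK : IsCompact K)
    (hKa : K ⊆ (extChartAt (𝓡∂ (d + 1)) a).source) :
    IsCompact (boundaryTarget d a ∩
      (fun z => (extChartAt (𝓡∂ (d + 1)) a).symm (boundaryIncl z)) ⁻¹' K) := by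
  have hemb : Topology.IsClosedEmbedding (boundaryIncl (d := d)) := by
    refine Function.LeftInverse.isClosedEmbedding
      (f := fun y : EuclideanSpace ℝ (Fin (d + 1)) => WithLp.toLp 2 fun i : Fin d => y i.succ)
      (fun z => rfl) ?_ continuous_boundaryIncl
    exact (PiLp.continuous_toLp 2 _).comp (by fun_prop)
  exact hemb.isCompact_preimage (isCompact_target_inter_preimage a hK hKa)

variable [IsManifold (𝓡∂ (d + 1)) ∞ M] (g : Metric d M)

lemma mapsTo_boundaryTarget (a : M) :
    MapsTo (fun z => (extChartAt (𝓡∂ (d + 1)) a).symm (boundaryIncl z)) (boundaryTarget d a)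
      ((extChartAt (𝓡∂ (d + 1)) a).source ∩ (𝓡∂ (d + 1)).boundary M) := by
  intro z hz
  have h := (extChartAt (𝓡∂ (d + 1)) a).map_target hz
  refine ⟨h, (mem_boundary_iff_chart h).2 ?_⟩
  rw [(extChartAt (𝓡∂ (d + 1)) a).right_inv hz, boundaryIncl_zero]

lemma continuousOn_surface_density (a : M) :
    ContinuousOn (fun z => Real.sqrt
      ((chartGram g a ((extChartAt (𝓡∂ (d + 1)) a).symm (boundaryIncl z))).submatrix
        Fin.succ Fin.succ).det) (boundaryTarget d a) := by
  refine Real.continuous_sqrt.comp_continuousOn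
    ((Continuous.matrix_det (A := fun G : Matrix (Fin (d + 1)) (Fin (d + 1)) ℝ =>
      G.submatrix Fin.succ Fin.succ) ?_).comp_continuousOn ?_)
  · exact continuous_id.matrix_submatrix _ _
  · exact (continuousOn_chartGram g a).comp (continuousOn_boundary_symm a)
      fun z hz => (mapsTo_boundaryTarget a hz).1

variable [MeasurableSpace M] [BorelSpace M]

lemma measurableSet_boundary : MeasurableSet ((𝓡∂ (d + 1)).boundary M) :=
  ((𝓡∂ (d + 1)).isClosed_boundary (n := ∞) (by simp)).measurableSet

lemma chartSurface_compl (a : M) : chartSurface g a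
    ((extChartAt (𝓡∂ (d + 1)) a).source ∩ (𝓡∂ (d + 1)).boundary M)ᶜ = 0 :=
  map_withDensity_eq_zero (measurableSet_boundaryTarget a) (aemeasurable_boundary_symm a)
    ((isOpen_extChartAt_source a).measurableSet.inter measurableSet_boundary)
    (mapsTo_boundaryTarget a)

lemma chartVolume_compl (a : M) : chartVolume g a (extChartAt (𝓡∂ (d + 1)) a).sourceᶜ = 0 :=
  map_withDensity_eq_zero (measurableSet_extChartAt_target a) (aemeasurable_extChartAt_symm a)
    (isOpen_extChartAt_source a).measurableSet (extChartAt (𝓡∂ (d + 1)) a).mapsTo_symm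

lemma integral_chartVolume (a : M) {F : M → ℂ}
    (hF : ContinuousOn F (extChartAt (𝓡∂ (d + 1)) a).source) :
    ∫ x, F x ∂(chartVolume g a) = ∫ y in (extChartAt (𝓡∂ (d + 1)) a).target,
      (Real.sqrt (chartGram g a ((extChartAt (𝓡∂ (d + 1)) a).symm y)).det : ℂ)
        * F ((extChartAt (𝓡∂ (d + 1)) a).symm y) :=
  integral_map_withDensity (measurableSet_extChartAt_target a) (continuousOn_density g a)
    (fun _ => Real.sqrt_nonneg _) (aemeasurable_extChartAt_symm a)
    (aestronglyMeasurable_of_continuousOn (isOpen_extChartAt_source a) hF (chartVolume_compl g a))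

lemma chartSurface_compl_source (a : M) :
    chartSurface g a (extChartAt (𝓡∂ (d + 1)) a).sourceᶜ = 0 :=
  measure_mono_null (compl_subset_compl.2 inter_subset_left) (chartSurface_compl g a)

lemma integral_chartSurface (a : M) {F : M → ℂ}
    (hF : ContinuousOn F (extChartAt (𝓡∂ (d + 1)) a).source) :
    ∫ x, F x ∂(chartSurface g a) = ∫ z in boundaryTarget d a,
      (Real.sqrt ((chartGram g a ((extChartAt (𝓡∂ (d + 1)) a).symm (boundaryIncl z))).submatrix
        Fin.succ Fin.succ).det : ℂ) * F ((extChartAt (𝓡∂ (d + 1)) a).symm (boundaryIncl z)) :=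
  integral_map_withDensity (measurableSet_boundaryTarget a) (continuousOn_surface_density g a)
    (fun _ => Real.sqrt_nonneg _) (aemeasurable_boundary_symm a)
    (aestronglyMeasurable_of_continuousOn (isOpen_extChartAt_source a) hF
      (chartSurface_compl_source g a))

variable [T2Space M]

lemma integrable_chartSurface (a : M) {F : M → ℂ} {K : Set M}
    (hF : ContinuousOn F (extChartAt (𝓡∂ (d + 1)) a).source) (hK : IsCompact K)
    (hKa : K ⊆ (extChartAt (𝓡∂ (d + 1)) a).source) (hs : Function.support F ⊆ K) :
    Integrable F (chartSurface g a) :=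
  integrable_of_continuousOn_compact hK hKa hF hs
    (map_withDensity_lt_top (continuousOn_surface_density g a)
      (aemeasurable_boundary_symm a) hK.measurableSet
      (isCompact_boundaryTarget_inter_preimage a hK hKa))

lemma chartVolume_lt_top (a : M) {K : Set M} (hK : IsCompact K)
    (hKa : K ⊆ (extChartAt (𝓡∂ (d + 1)) a).source) : chartVolume g a K < ⊤ :=
  map_withDensity_lt_top (continuousOn_density g a)
    (aemeasurable_extChartAt_symm a) hK.measurableSet (isCompact_target_inter_preimage a hK hKa)

variable [CompactSpace M]

instance isFiniteMeasure_volumeMeasure : IsFiniteMeasure (volumeMeasure g) := by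
  refine ⟨isCompact_univ.measure_lt_top_of_nhdsWithin fun x _ => ?_⟩
  obtain ⟨K, hK, hxK, hKs⟩ := exists_compact_subset (isOpen_extChartAt_source (I := 𝓡∂ (d + 1)) x)
    (mem_extChartAt_source x)
  refine ⟨K, mem_nhdsWithin_of_mem_nhds (mem_interior_iff_mem_nhds.1 hxK), ?_⟩
  have h := chartVolume_lt_top g x hK hKs
  rwa [← volumeMeasure_restrict_source, Measure.restrict_apply hK.measurableSet,
    inter_eq_left.2 hKs] at h

lemma integrable_volumeMeasure {F : M → ℂ} (hF : Continuous F) :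
    Integrable F (volumeMeasure g) :=
  integrable_of_continuousOn_compact isCompact_univ subset_rfl hF.continuousOn (subset_univ _)
    (measure_lt_top _ _)

/-- The integral over `M` of a function supported in the domain of one chart. -/
lemma integral_volumeMeasure_of_support (a : M) {F : M → ℂ}
    (hF : ContinuousOn F (extChartAt (𝓡∂ (d + 1)) a).source)
    (hs : Function.support F ⊆ (extChartAt (𝓡∂ (d + 1)) a).source) :
    ∫ x, F x ∂(volumeMeasure g) = ∫ y in (extChartAt (𝓡∂ (d + 1)) a).target,
      (Real.sqrt (chartGram g a ((extChartAt (𝓡∂ (d + 1)) a).symm y)).det : ℂ)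
        * F ((extChartAt (𝓡∂ (d + 1)) a).symm y) := by
  rw [← setIntegral_eq_integral_of_forall_compl_eq_zero (s := (extChartAt (𝓡∂ (d + 1)) a).source)
    (fun x hx => by_contra fun h => hx (hs h)), volumeMeasure_restrict_source,
    integral_chartVolume g a hF]

lemma integrable_surfaceMeasure {ψ : M → ℂ}
    (hψ : ∀ a : M, Integrable (fun x => (chartPartition d M a x : ℂ) * ψ x) (chartSurface g a)) :
    Integrable (fun p : (𝓡∂ (d + 1)).boundary M => ψ p) (surfaceMeasure g) := by
  rw [surfaceMeasure]
  have hme := MeasurableEmbedding.subtype_coe (measurableSet_boundary (d := d) (M := M))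
  refine (hme.integrable_map_iff (g := ψ)).1 ?_
  rw [map_comap_subtype_coe measurableSet_boundary]
  refine Integrable.integrableOn ?_
  rw [finite_indices_sum, integrable_finsetSum_measure]
  intro a _
  refine (integrable_withDensity_iff_integrable_smul'
    (measurable_chartPartition a) (by simp)).2 ?_
  refine (hψ a).congr (Filter.Eventually.of_forall fun x => ?_)
  simp [ENNReal.toReal_ofReal ((chartPartition d M).nonneg a x)]

lemma integral_surfaceMeasure {ψ : M → ℂ}
    (hψ : ∀ a : M, Integrable (fun x => (chartPartition d M a x : ℂ) * ψ x) (chartSurface g a)) :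
    ∫ p : (𝓡∂ (d + 1)).boundary M, ψ p ∂(surfaceMeasure g)
      = ∑ a ∈ (finite_chartPartition_support d M).toFinset,
        ∫ x, (chartPartition d M a x : ℂ) * ψ x ∂(chartSurface g a) := by
  have key : ∀ a : M, ∀ x, (ENNReal.ofReal (chartPartition d M a x)).toReal • ψ x
      = (chartPartition d M a x : ℂ) * ψ x := fun a x => by
    simp [ENNReal.toReal_ofReal ((chartPartition d M).nonneg a x)]
  rw [surfaceMeasure, integral_subtype_comap measurableSet_boundary, finite_indices_sum,
    Measure.restrict_eq_self_of_ae_mem, integral_finsetSum_measure]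
  · refine Finset.sum_congr rfl fun a _ => ?_
    rw [integral_withDensity_eq_integral_toReal_smul (measurable_chartPartition a) (by simp)]
    simp only [key]
  · intro a _
    refine (integrable_withDensity_iff_integrable_smul'
      (measurable_chartPartition a) (by simp)).2 ?_
    simpa only [key] using hψ a
  · change _ = 0
    rw [Measure.finsetSum_apply]
    refine Finset.sum_eq_zero fun a _ => withDensity_absolutelyContinuous _ _ ?_
    exact measure_mono_null (compl_subset_compl.2 inter_subset_right) (chartSurface_compl g a)

end ChartMeasures

/-! ### A smooth cutoff on the line -/

section Cutoff

/-- A smooth cutoff on the line: it vanishes for `t ≤ 1` and equals `1` for `2 ≤ t`. -/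
def cutoff (t : ℝ) : ℝ := Real.smoothTransition (t - 1)

lemma contDiff_cutoff : ContDiff ℝ ∞ cutoff :=
  Real.smoothTransition.contDiff.comp (contDiff_id.sub contDiff_const)

lemma cutoff_eq_zero {t : ℝ} (h : t ≤ 1) : cutoff t = 0 :=
  Real.smoothTransition.zero_of_nonpos (by linarith)

lemma cutoff_eq_one {t : ℝ} (h : 2 ≤ t) : cutoff t = 1 :=
  Real.smoothTransition.one_of_one_le (by linarith)

lemma cutoff_nonneg (t : ℝ) : 0 ≤ cutoff t := Real.smoothTransition.nonneg _

lemma cutoff_le_one (t : ℝ) : cutoff t ≤ 1 := Real.smoothTransition.le_one _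

lemma continuous_deriv_cutoff : Continuous (deriv cutoff) :=
  contDiff_cutoff.continuous_deriv (by simp)

lemma deriv_cutoff_of_lt {t : ℝ} (h : t < 1) : deriv cutoff t = 0 := by
  have : cutoff =ᶠ[nhds t] fun _ => 0 := by
    filter_upwards [Iio_mem_nhds h] with s hs using cutoff_eq_zero (le_of_lt hs)
  rw [this.deriv_eq, deriv_const]

lemma deriv_cutoff_of_gt {t : ℝ} (h : 2 < t) : deriv cutoff t = 0 := by
  have : cutoff =ᶠ[nhds t] fun _ => 1 := by
    filter_upwards [Ioi_mem_nhds h] with s hs using cutoff_eq_one (le_of_lt hs)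
  rw [this.deriv_eq, deriv_const]

lemma support_deriv_cutoff : Function.support (deriv cutoff) ⊆ Icc 1 2 := by
  intro t ht
  by_contra h
  rw [mem_Icc, not_and_or, not_le, not_le] at h
  exact ht (h.elim deriv_cutoff_of_lt deriv_cutoff_of_gt)

lemma integrable_deriv_cutoff : Integrable (deriv cutoff) :=
  continuous_deriv_cutoff.integrable_of_hasCompactSupport
    (HasCompactSupport.of_support_subset_isCompact isCompact_Icc support_deriv_cutoff)

lemma integral_deriv_cutoff : ∫ t, deriv cutoff t = 1 := by
  rw [← setIntegral_eq_integral_of_forall_compl_eq_zero (s := Icc 1 2)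
    (fun t ht => by_contra fun h => ht (support_deriv_cutoff h)), integral_Icc_eq_integral_Ioc,
    ← intervalIntegral.integral_of_le (by norm_num),
    intervalIntegral.integral_deriv_eq_sub (fun t _ =>
      (contDiff_cutoff.differentiable (by simp)).differentiableAt)
      (continuous_deriv_cutoff.intervalIntegrable _ _),
    cutoff_eq_one le_rfl, cutoff_eq_zero le_rfl, sub_zero]

end Cutoff

/-! ### Cutoff integrals on the half space -/

section HalfSpace

variable {d : ℕ}

/-- The splitting `ℝ × ℝ^d ≃ ℝ^{d+1}` that singles out the coordinate `0`. -/
def consEquiv (d : ℕ) : ℝ × EuclideanSpace ℝ (Fin d) ≃ᵐ EuclideanSpace ℝ (Fin (d + 1)) :=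
  ((MeasurableEquiv.refl ℝ).prodCongr (MeasurableEquiv.toLp 2 (Fin d → ℝ)).symm).trans
    ((MeasurableEquiv.piFinSuccAbove (fun _ => ℝ) 0).symm.trans
      (MeasurableEquiv.toLp 2 (Fin (d + 1) → ℝ)))

lemma consEquiv_apply (t : ℝ) (z : EuclideanSpace ℝ (Fin d)) :
    consEquiv d (t, z) = WithLp.toLp 2 (Fin.cons t fun i => z i) := by
  simp [consEquiv, MeasurableEquiv.piFinSuccAbove, Fin.insertNthEquiv]
  constructor
  · rfl
  · rfl

lemma consEquiv_zero (z : EuclideanSpace ℝ (Fin d)) : consEquiv d (0, z) = boundaryIncl z :=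
  consEquiv_apply 0 z

lemma consEquiv_apply_zero (t : ℝ) (z : EuclideanSpace ℝ (Fin d)) : consEquiv d (t, z) 0 = t := by
  rw [consEquiv_apply]; rfl

lemma continuous_consEquiv : Continuous (consEquiv d) := by
  have : (consEquiv d : _ → _) = fun p : ℝ × EuclideanSpace ℝ (Fin d) =>
      WithLp.toLp 2 (Fin.cons p.1 fun i => p.2 i : Fin (d + 1) → ℝ) :=
    funext fun p => consEquiv_apply p.1 p.2
  rw [this]
  refine (PiLp.continuous_toLp 2 _).comp (continuous_pi fun i => ?_)
  refine Fin.cases ?_ (fun j => ?_) i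
  · simpa using continuous_fst
  · simp only [Fin.cons_succ]
    fun_prop

lemma measurePreserving_consEquiv :
    MeasurePreserving (consEquiv d) (volume : Measure (ℝ × EuclideanSpace ℝ (Fin d))) volume := by
  refine (PiLp.volume_preserving_toLp _).comp
    (((volume_preserving_piFinSuccAbove (fun _ : Fin (d + 1) => ℝ) 0).symm).comp
      ((MeasurePreserving.id volume).prod (PiLp.volume_preserving_ofLp (Fin d))))

lemma volume_zero_coord :
    (volume : Measure (EuclideanSpace ℝ (Fin (d + 1)))) {y | y 0 = 0} = 0 := by
  have hm : MeasurableSet {y : EuclideanSpace ℝ (Fin (d + 1)) | y 0 = 0} :=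
    (isClosed_eq (by fun_prop) continuous_const).measurableSet
  rw [← measurePreserving_consEquiv.measure_preimage hm.nullMeasurableSet]
  have : consEquiv d ⁻¹' {y | y 0 = 0} = ({0} : Set ℝ) ×ˢ univ := by
    ext ⟨t, z⟩
    simp [consEquiv_apply_zero]
  rw [this, Measure.volume_eq_prod, Measure.prod_prod]
  simp

/-- As `ε → 0`, the cutoff at distance `ε` from the boundary of the half space disappears. -/
lemma tendsto_integral_cutoff {w : EuclideanSpace ℝ (Fin (d + 1)) → ℂ} (hw : Integrable w)
    (h0 : ∀ y, y 0 < 0 → w y = 0) :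
    Tendsto (fun ε : ℝ => ∫ y, (cutoff (y 0 / ε) : ℂ) * w y) (𝓝[>] 0) (𝓝 (∫ y, w y)) := by
  refine tendsto_integral_filter_of_dominated_convergence (fun y => ‖w y‖) ?_ ?_ hw.norm ?_
  · refine Eventually.of_forall fun ε => AEStronglyMeasurable.mul ?_ hw.aestronglyMeasurable
    refine (Complex.continuous_ofReal.comp
      (contDiff_cutoff.continuous.comp ?_)).aestronglyMeasurable
    fun_prop
  · refine Eventually.of_forall fun ε => Eventually.of_forall fun y => ?_
    rw [norm_mul, Complex.norm_real, Real.norm_of_nonneg (cutoff_nonneg _)]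
    exact mul_le_of_le_one_left (norm_nonneg _) (cutoff_le_one _)
  · have hae : ∀ᵐ y : EuclideanSpace ℝ (Fin (d + 1)), y 0 ≠ 0 := by
      rw [ae_iff]; simpa using volume_zero_coord
    filter_upwards [hae] with y hy
    rcases lt_or_gt_of_ne hy with h | h
    · simp [h0 y h]
    · refine tendsto_const_nhds.congr' ?_
      filter_upwards [Ioo_mem_nhdsGT (show (0 : ℝ) < y 0 / 2 by linarith)] with ε hε
      rw [cutoff_eq_one, Complex.ofReal_one, one_mul]
      rw [le_div_iff₀ hε.1]
      have := hε.2
      linarith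

/-- The kernels `ε⁻¹ χ'(y₀ / ε)` concentrate on the boundary of the half space. -/
lemma tendsto_integral_deriv_cutoff {n : EuclideanSpace ℝ (Fin (d + 1)) → ℂ}
    {K : Set (EuclideanSpace ℝ (Fin (d + 1)))} (hK : IsCompact K) (hKH : K ⊆ {y | 0 ≤ y 0})
    (hn : ContinuousOn n {y | 0 ≤ y 0}) (hs : Function.support n ⊆ K) :
    Tendsto (fun ε : ℝ => ∫ y, ((ε⁻¹ * deriv cutoff (y 0 / ε) : ℝ) : ℂ) * n y) (𝓝[>] 0)
      (𝓝 (∫ z, n (boundaryIncl z))) := by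
  have hint : Integrable n := integrable_of_continuousOn_compact hK hKH hn hs hK.measure_lt_top
  obtain ⟨C, hC⟩ := hK.exists_bound_of_continuousOn (hn.mono hKH)
  have hC' : ∀ y, ‖n y‖ ≤ max C 0 := by
    intro y
    by_cases hy : y ∈ K
    · exact (hC y hy).trans (le_max_left _ _)
    · rw [show n y = 0 from by_contra fun h => hy (hs h), norm_zero]
      exact le_max_right _ _
  set p : EuclideanSpace ℝ (Fin (d + 1)) → EuclideanSpace ℝ (Fin d) :=
    fun y => WithLp.toLp 2 fun i : Fin d => y i.succ with hp
  have hpc : Continuous p := (PiLp.continuous_toLp 2 _).comp (by fun_prop)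
  have hpe : ∀ t z, p (consEquiv d (t, z)) = z := fun t z => by
    rw [consEquiv_apply]; rfl
  obtain ⟨C1, hC1⟩ := (isCompact_Icc (a := (1 : ℝ)) (b := 2)).exists_bound_of_continuousOn
    continuous_deriv_cutoff.continuousOn
  have hC1' : ∀ t, ‖deriv cutoff t‖ ≤ max C1 0 := by
    intro t
    by_cases ht : t ∈ Icc (1 : ℝ) 2
    · exact (hC1 t ht).trans (le_max_left _ _)
    · rw [show deriv cutoff t = 0 from by_contra fun h => ht (support_deriv_cutoff h), norm_zero]
      exact le_max_right _ _
  -- Fubini, and the substitution `t = ε s` in the coordinate normal to the boundary.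
  have hfub : ∀ ε : ℝ, 0 < ε →
      Integrable (fun z => ∫ s, ((deriv cutoff s : ℝ) : ℂ) * n (consEquiv d (ε * s, z))) ∧
      ∫ y, ((ε⁻¹ * deriv cutoff (y 0 / ε) : ℝ) : ℂ) * n y
        = ∫ z, ∫ s, ((deriv cutoff s : ℝ) : ℂ) * n (consEquiv d (ε * s, z)) := by
    intro ε hε
    have hI : Integrable (fun y => ((ε⁻¹ * deriv cutoff (y 0 / ε) : ℝ) : ℂ) * n y) := by
      refine hint.bdd_mul (c := ‖ε⁻¹‖ * max C1 0) ?_ ?_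
      · refine (Complex.continuous_ofReal.comp (continuous_const.mul
          (continuous_deriv_cutoff.comp ?_))).aestronglyMeasurable
        fun_prop
      · refine Eventually.of_forall fun y => ?_
        rw [Complex.norm_real, norm_mul]
        exact mul_le_mul_of_nonneg_left (hC1' _) (norm_nonneg _)
    have hI2 := measurePreserving_consEquiv.integrable_comp_emb
      (consEquiv d).measurableEmbedding |>.2 hI
    rw [Measure.volume_eq_prod] at hI2
    have hin : ∀ z, ∫ t,
        ((fun y => ((ε⁻¹ * deriv cutoff (y 0 / ε) : ℝ) : ℂ) * n y) ∘ consEquiv d) (t, z)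
        = ∫ s, ((deriv cutoff s : ℝ) : ℂ) * n (consEquiv d (ε * s, z)) := by
      intro z
      have := Measure.integral_comp_mul_left (fun t => ((fun y =>
        ((ε⁻¹ * deriv cutoff (y 0 / ε) : ℝ) : ℂ) * n y) ∘ consEquiv d) (t, z)) ε
      rw [abs_of_pos (inv_pos.2 hε)] at this
      rw [← inv_smul_smul₀ (inv_ne_zero hε.ne') (∫ t, ((fun y =>
        ((ε⁻¹ * deriv cutoff (y 0 / ε) : ℝ) : ℂ) * n y) ∘ consEquiv d) (t, z)), ← this,
        ← integral_smul]
      refine integral_congr_ae (Eventually.of_forall fun s => ?_)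
      simp only [Function.comp_apply, consEquiv_apply_zero, inv_inv, Complex.real_smul,
        mul_div_cancel_left₀ _ hε.ne']
      push_cast
      have hεc : (ε : ℂ) ≠ 0 := Complex.ofReal_ne_zero.2 hε.ne'
      field_simp
    have h1 := hI2.integral_prod_right
    simp only [hin] at h1
    refine ⟨h1, ?_⟩
    rw [← measurePreserving_consEquiv.integral_comp (consEquiv d).measurableEmbedding,
      Measure.volume_eq_prod]
    exact (integral_prod_symm _ hI2).trans (integral_congr_ae (Eventually.of_forall hin))
  have hev : ∀ᶠ ε : ℝ in 𝓝[>] 0, 0 < ε := self_mem_nhdsWithin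
  refine Tendsto.congr'
    (f₁ := fun ε => ∫ z, ∫ s, ((deriv cutoff s : ℝ) : ℂ) * n (consEquiv d (ε * s, z)))
    (hev.mono fun ε hε => ((hfub ε hε).2).symm) ?_
  have hcpt : IsCompact (p '' K) := hK.image hpc
  refine tendsto_integral_filter_of_dominated_convergence
    ((p '' K).indicator fun _ => ∫ s, ‖deriv cutoff s‖ * max C 0) ?_ ?_ ?_ ?_
  · exact hev.mono fun ε hε => (hfub ε hε).1.aestronglyMeasurable
  · refine hev.mono fun ε hε => Eventually.of_forall fun z => ?_
    by_cases hz : z ∈ p '' K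
    · rw [indicator_of_mem hz]
      refine norm_integral_le_of_norm_le (integrable_deriv_cutoff.norm.mul_const _)
        (Eventually.of_forall fun s => ?_)
      rw [norm_mul, Complex.norm_real]
      exact mul_le_mul_of_nonneg_left (hC' _) (norm_nonneg _)
    · rw [indicator_of_notMem hz]
      have : ∀ s, n (consEquiv d (ε * s, z)) = 0 := fun s => by
        by_contra h
        exact hz ⟨_, hs h, hpe _ _⟩
      simp [this]
  · exact (integrable_indicator_iff hcpt.measurableSet).2
      (integrableOn_const hcpt.measure_lt_top.ne)
  · refine Eventually.of_forall fun z => ?_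
    have hlim : n (boundaryIncl z) = ∫ s, ((deriv cutoff s : ℝ) : ℂ) * n (boundaryIncl z) := by
      rw [integral_mul_const, integral_complex_ofReal, integral_deriv_cutoff]
      simp
    rw [hlim]
    refine tendsto_integral_filter_of_dominated_convergence
      (fun s => ‖deriv cutoff s‖ * max C 0) ?_ ?_ (integrable_deriv_cutoff.norm.mul_const _) ?_
    · refine hev.mono fun ε hε => ?_
      have hind : (fun s => ((deriv cutoff s : ℝ) : ℂ) * n (consEquiv d (ε * s, z)))
          = (Ici 0).indicator fun s => ((deriv cutoff s : ℝ) : ℂ) * n (consEquiv d (ε * s, z)) := by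
        ext s
        by_cases hs0 : s ∈ Ici (0 : ℝ)
        · rw [indicator_of_mem hs0]
        · rw [indicator_of_notMem hs0, deriv_cutoff_of_lt (by rw [mem_Ici] at hs0; linarith)]
          simp
      rw [hind, aestronglyMeasurable_indicator_iff measurableSet_Ici]
      refine ContinuousOn.aestronglyMeasurable (ContinuousOn.mul
        (Complex.continuous_ofReal.comp continuous_deriv_cutoff).continuousOn
        (hn.comp (continuous_consEquiv.comp (by fun_prop)).continuousOn fun s hs => ?_))
        measurableSet_Ici
      rw [mem_ofPred_eq, consEquiv_apply_zero]
      exact mul_nonneg hε.le hs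
    · refine Eventually.of_forall fun ε => Eventually.of_forall fun s => ?_
      rw [norm_mul, Complex.norm_real]
      exact mul_le_mul_of_nonneg_left (hC' _) (norm_nonneg _)
    · refine Eventually.of_forall fun s => ?_
      by_cases hs1 : s < 1
      · simp [deriv_cutoff_of_lt hs1]
      · refine Tendsto.const_mul _ ?_
        have hc : ContinuousWithinAt n {y | 0 ≤ y 0} (boundaryIncl z) :=
          hn _ (by simp [boundaryIncl_zero])
        refine hc.tendsto.comp (tendsto_nhdsWithin_iff.2 ⟨?_, ?_⟩)
        · rw [← consEquiv_zero]
          have : Continuous fun ε : ℝ => consEquiv d (ε * s, z) :=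
            continuous_consEquiv.comp (by fun_prop)
          have h2 := this.tendsto 0
          rw [zero_mul] at h2
          exact h2.mono_left nhdsWithin_le_nhds
        · filter_upwards [hev] with ε hε
          change 0 ≤ consEquiv d (ε * s, z) 0
          rw [consEquiv_apply_zero]
          exact mul_nonneg hε.le (by linarith)

end HalfSpace

/-! ### The Hermitian inner product -/

section Herm

variable {m : ℕ}

lemma herm_add_left (a b c : Fin m → ℂ) : herm (a + b) c = herm a c + herm b c := by
  simp [herm, add_mul, Finset.sum_add_distrib]

lemma herm_add_right (a b c : Fin m → ℂ) : herm a (b + c) = herm a b + herm a c := by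
  simp [herm, mul_add, Finset.sum_add_distrib]

lemma herm_sub_left (a b c : Fin m → ℂ) : herm (a - b) c = herm a c - herm b c := by
  simp [herm, sub_mul, Finset.sum_sub_distrib]

lemma herm_neg_left (a b : Fin m → ℂ) : herm (-a) b = -herm a b := by
  simp [herm]

lemma herm_smul_left (r : ℝ) (a b : Fin m → ℂ) : herm (r • a) b = r * herm a b := by
  simp [herm, Finset.mul_sum, mul_assoc]

lemma herm_smul_right (r : ℝ) (a b : Fin m → ℂ) : herm a (r • b) = r * herm a b := by
  simp [herm, Finset.mul_sum, mul_left_comm]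

lemma herm_zero_right (a : Fin m → ℂ) : herm a 0 = 0 := by simp [herm]

lemma conj_herm (a b : Fin m → ℂ) : conj (herm a b) = herm b a := by
  simp [herm, map_sum, mul_comm]

lemma herm_sum_left {ι : Type*} (s : Finset ι) (a : ι → Fin m → ℂ) (b : Fin m → ℂ) :
    herm (∑ i ∈ s, a i) b = ∑ i ∈ s, herm (a i) b := by
  simp only [herm, Finset.sum_apply, Finset.sum_mul]
  exact Finset.sum_comm

lemma continuousOn_herm {X : Type*} [TopologicalSpace X] {s : Set X} {f h : X → Fin m → ℂ}
    (hf : ContinuousOn f s) (hh : ContinuousOn h s) :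
    ContinuousOn (fun x => herm (f x) (h x)) s :=
  continuousOn_finsetSum _ fun k _ => (continuousOn_pi.1 hf k).mul
    (Complex.continuous_conj.comp_continuousOn (continuousOn_pi.1 hh k))

end Herm

/-! ### The covariant derivative -/

section CovDeriv

variable {d m : ℕ} {M : Type*} [TopologicalSpace M]
  [ChartedSpace (EuclideanHalfSpace (d + 1)) M]

lemma hasMFDerivAt_smul {h : M → ℝ} {u : M → Fin m → ℂ} {x : M}
    {h' : TangentSpace (𝓡∂ (d + 1)) x →L[ℝ] ℝ}
    {u' : TangentSpace (𝓡∂ (d + 1)) x →L[ℝ] (Fin m → ℂ)}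
    (hh : HasMFDerivAt (𝓡∂ (d + 1)) 𝓘(ℝ, ℝ) h x h')
    (hu : HasMFDerivAt (𝓡∂ (d + 1)) 𝓘(ℝ, Fin m → ℂ) u x u') :
    HasMFDerivAt (𝓡∂ (d + 1)) 𝓘(ℝ, Fin m → ℂ) (fun y => h y • u y) x
      (h x • u' + h'.smulRight (u x)) := by
  refine ⟨hh.1.smul hu.1, ?_⟩
  have h1 := HasFDerivWithinAt.smul hh.2 hu.2
  have e1 : writtenInExtChartAt (𝓡∂ (d + 1)) 𝓘(ℝ, ℝ) x h (extChartAt (𝓡∂ (d + 1)) x x) = h x := by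
    change h ((extChartAt (𝓡∂ (d + 1)) x).symm (extChartAt (𝓡∂ (d + 1)) x x)) = _
    rw [extChartAt_to_inv]
  have e2 : writtenInExtChartAt (𝓡∂ (d + 1)) 𝓘(ℝ, Fin m → ℂ) x u
      (extChartAt (𝓡∂ (d + 1)) x x) = u x := by
    change u ((extChartAt (𝓡∂ (d + 1)) x).symm (extChartAt (𝓡∂ (d + 1)) x x)) = _
    rw [extChartAt_to_inv]
  rw [e1, e2] at h1
  exact h1

/-- The differential of a section, as a covector with values in `ℂ^m`. -/
def sectionDeriv (d : ℕ) {m : ℕ} {M : Type*} [TopologicalSpace M]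
    [ChartedSpace (EuclideanHalfSpace (d + 1)) M] (u : M → Fin m → ℂ) (x : M) :
    TangentSpace (𝓡∂ (d + 1)) x →L[ℝ] (Fin m → ℂ) :=
  mfderiv (𝓡∂ (d + 1)) 𝓘(ℝ, Fin m → ℂ) u x

lemma covDeriv_apply (A : Matrix (Fin m) (Fin m) (OneForm d M)) (u : M → Fin m → ℂ) (x : M)
    (X : TangentSpace (𝓡∂ (d + 1)) x) (k : Fin m) :
    covDeriv A u x X k = sectionDeriv d u x X k + ∑ l, A k l x X * u x l := by
  change sectionDeriv d u x X k + (∑ l, u x l • A k l x) X = _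
  rw [sum_apply]
  congr 1
  exact Finset.sum_congr rfl fun l _ => mul_comm _ _

lemma sectionDeriv_smul {h : M → ℝ} {u : M → Fin m → ℂ}
    {x : M} {h' : TangentSpace (𝓡∂ (d + 1)) x →L[ℝ] ℝ}
    (hh : HasMFDerivAt (𝓡∂ (d + 1)) 𝓘(ℝ, ℝ) h x h')
    (hu : MDifferentiableAt (𝓡∂ (d + 1)) 𝓘(ℝ, Fin m → ℂ) u x) :
    sectionDeriv d (fun y => h y • u y) x = h x • sectionDeriv d u x + h'.smulRight (u x) :=
  (hasMFDerivAt_smul hh hu.hasMFDerivAt).mfderiv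

lemma sectionDeriv_add {u v : M → Fin m → ℂ} {x : M}
    (hu : MDifferentiableAt (𝓡∂ (d + 1)) 𝓘(ℝ, Fin m → ℂ) u x)
    (hv : MDifferentiableAt (𝓡∂ (d + 1)) 𝓘(ℝ, Fin m → ℂ) v x) :
    sectionDeriv d (fun y => u y + v y) x = sectionDeriv d u x + sectionDeriv d v x :=
  (hu.hasMFDerivAt.add hv.hasMFDerivAt).mfderiv

lemma sectionDeriv_sub {u v : M → Fin m → ℂ} {x : M}
    (hu : MDifferentiableAt (𝓡∂ (d + 1)) 𝓘(ℝ, Fin m → ℂ) u x)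
    (hv : MDifferentiableAt (𝓡∂ (d + 1)) 𝓘(ℝ, Fin m → ℂ) v x) :
    sectionDeriv d (fun y => u y - v y) x = sectionDeriv d u x - sectionDeriv d v x :=
  (hu.hasMFDerivAt.sub hv.hasMFDerivAt).mfderiv

lemma covDeriv_smul (A : Matrix (Fin m) (Fin m) (OneForm d M)) {h : M → ℝ} {u : M → Fin m → ℂ}
    {x : M} {h' : TangentSpace (𝓡∂ (d + 1)) x →L[ℝ] ℝ}
    (hh : HasMFDerivAt (𝓡∂ (d + 1)) 𝓘(ℝ, ℝ) h x h')
    (hu : MDifferentiableAt (𝓡∂ (d + 1)) 𝓘(ℝ, Fin m → ℂ) u x)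
    (X : TangentSpace (𝓡∂ (d + 1)) x) :
    covDeriv A (fun y => h y • u y) x X = h x • covDeriv A u x X + h' X • u x := by
  ext k
  rw [Pi.add_apply, Pi.smul_apply, Pi.smul_apply, covDeriv_apply, covDeriv_apply,
    sectionDeriv_smul hh hu, smul_add, Finset.smul_sum]
  change (h x • sectionDeriv d u x X k + h' X • u x k) + ∑ l, A k l x X * (h x • u x l)
    = h x • sectionDeriv d u x X k + ∑ l, h x • (A k l x X * u x l) + h' X • u x k
  simp only [mul_smul_comm]
  ring

lemma covDeriv_add (A : Matrix (Fin m) (Fin m) (OneForm d M)) {u v : M → Fin m → ℂ} {x : M}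
    (hu : MDifferentiableAt (𝓡∂ (d + 1)) 𝓘(ℝ, Fin m → ℂ) u x)
    (hv : MDifferentiableAt (𝓡∂ (d + 1)) 𝓘(ℝ, Fin m → ℂ) v x) :
    covDeriv A (fun y => u y + v y) x = covDeriv A u x + covDeriv A v x := by
  ext X k
  rw [add_apply, Pi.add_apply, covDeriv_apply, covDeriv_apply, covDeriv_apply,
    sectionDeriv_add hu hv, add_apply, Pi.add_apply]
  simp only [Pi.add_apply, mul_add, Finset.sum_add_distrib]
  ring

lemma covDeriv_sub (A : Matrix (Fin m) (Fin m) (OneForm d M)) {u v : M → Fin m → ℂ} {x : M}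
    (hu : MDifferentiableAt (𝓡∂ (d + 1)) 𝓘(ℝ, Fin m → ℂ) u x)
    (hv : MDifferentiableAt (𝓡∂ (d + 1)) 𝓘(ℝ, Fin m → ℂ) v x) :
    covDeriv A (fun y => u y - v y) x = covDeriv A u x - covDeriv A v x := by
  ext X k
  rw [sub_apply, Pi.sub_apply, covDeriv_apply, covDeriv_apply, covDeriv_apply,
    sectionDeriv_sub hu hv, sub_apply, Pi.sub_apply]
  simp only [Pi.sub_apply, mul_sub, Finset.sum_sub_distrib]
  ring

lemma IsSmoothSection.mdifferentiableAt {u : M → Fin m → ℂ} (hu : IsSmoothSection d u) (x : M) :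
    MDifferentiableAt (𝓡∂ (d + 1)) 𝓘(ℝ, Fin m → ℂ) u x :=
  (hu x).mdifferentiableAt (by simp)

variable [IsManifold (𝓡∂ (d + 1)) ∞ M]

/-- A covector field with values in `ℂ^m` is continuous if its components in every chart are. -/
def ContinuousForm (α : ∀ x : M, TangentSpace (𝓡∂ (d + 1)) x →L[ℝ] (Fin m → ℂ)) : Prop :=
  ∀ (a : M) (i : Fin (d + 1)),
    ContinuousOn (fun x => α x (chartFrame a x i)) (extChartAt (𝓡∂ (d + 1)) a).source

lemma continuousForm_covDeriv {A : Matrix (Fin m) (Fin m) (OneForm d M)}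
    (hA : ∀ k l, OneForm.IsSmooth (A k l)) {u : M → Fin m → ℂ} (hu : IsSmoothSection d u) :
    ContinuousForm (covDeriv A u) := by
  intro a i
  refine continuousOn_pi.2 fun k => ?_
  simp only [covDeriv_apply]
  refine ContinuousOn.add ?_ (continuousOn_finsetSum _ fun l _ => ContinuousOn.mul ?_ ?_)
  · exact (continuous_apply k).comp_continuousOn (continuousOn_mfderiv_chartFrame hu a i)
  · exact continuousOn_chartFrame_apply _ (hA k l) a i
  · exact ((continuous_apply l).comp hu.continuous).continuousOn

variable (g : Metric d M)

lemma continuousOn_inv_chartGram (a : M) :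
    ContinuousOn (fun x => (chartGram g a x)⁻¹) (extChartAt (𝓡∂ (d + 1)) a).source := by
  have h := continuousOn_chartGram g a
  have h1 : ContinuousOn (fun x => (chartGram g a x).det) (extChartAt (𝓡∂ (d + 1)) a).source :=
    (continuous_id.matrix_det : Continuous fun G : Matrix (Fin (d + 1)) (Fin (d + 1)) ℝ =>
      G.det).comp_continuousOn h
  have h2 : ContinuousOn (fun x => (chartGram g a x).adjugate)
      (extChartAt (𝓡∂ (d + 1)) a).source :=
    (continuous_id.matrix_adjugate : Continuous fun G : Matrix (Fin (d + 1)) (Fin (d + 1)) ℝ =>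
      G.adjugate).comp_continuousOn h
  simp only [Matrix.inv_def, Ring.inverse_eq_inv']
  exact (h1.inv₀ fun x hx => (chartGram_posDef g hx).det_pos.ne').smul h2

lemma continuousOn_inv_chartGram_apply (a : M) (i j : Fin (d + 1)) :
    ContinuousOn (fun x => (((chartGram g a x)⁻¹ i j : ℝ) : ℂ))
      (extChartAt (𝓡∂ (d + 1)) a).source := by
  refine Complex.continuous_ofReal.comp_continuousOn ?_
  exact continuousOn_pi.1 (continuousOn_pi.1 (continuousOn_inv_chartGram g a) i) j

lemma continuous_vecFormInner {α β : ∀ x : M, TangentSpace (𝓡∂ (d + 1)) x →L[ℝ] (Fin m → ℂ)}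
    (hα : ContinuousForm α) (hβ : ContinuousForm β) :
    Continuous fun x => vecFormInner g x (α x) (β x) := by
  refine continuous_iff_continuousAt.2 fun a => ?_
  have hopen := isOpen_extChartAt_source (I := 𝓡∂ (d + 1)) a
  have h : ContinuousOn (fun x => vecFormInner g x (α x) (β x))
      (extChartAt (𝓡∂ (d + 1)) a).source := by
    refine ContinuousOn.congr (f := fun x => chartVecFormInner g a x (α x) (β x)) ?_
      fun x hx => vecFormInner_eq_chart g hx _ _
    unfold chartVecFormInner
    refine continuousOn_finsetSum _ fun i _ => continuousOn_finsetSum _ fun j _ =>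
      (continuousOn_inv_chartGram_apply g a i j).mul ?_
    exact continuousOn_herm (hα a i) (hβ a j)
  exact h.continuousAt (hopen.mem_nhds (mem_extChartAt_source a))

end CovDeriv

/-! ### Functions read in a chart -/

section Pullback

variable {d : ℕ} {M : Type*} [TopologicalSpace M]
  [ChartedSpace (EuclideanHalfSpace (d + 1)) M]

/-- A function on `M` read in the preferred chart at `a`, extended by zero. -/
def chartPullback (d : ℕ) {M : Type*} [TopologicalSpace M]
    [ChartedSpace (EuclideanHalfSpace (d + 1)) M] (a : M) (F : M → ℂ) :
    EuclideanSpace ℝ (Fin (d + 1)) → ℂ :=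
  (extChartAt (𝓡∂ (d + 1)) a).target.indicator fun y => F ((extChartAt (𝓡∂ (d + 1)) a).symm y)

lemma extChartAt_target_subset_halfSpace (a : M) :
    (extChartAt (𝓡∂ (d + 1)) a).target ⊆ {y | 0 ≤ y 0} := by
  have := extChartAt_target_subset_range (I := 𝓡∂ (d + 1)) a
  rwa [range_modelWithCornersEuclideanHalfSpace] at this

lemma support_chartPullback (a : M) {F : M → ℂ} {K : Set M} (hs : Function.support F ⊆ K) :
    Function.support (chartPullback d a F) ⊆
      (extChartAt (𝓡∂ (d + 1)) a).target ∩ (extChartAt (𝓡∂ (d + 1)) a).symm ⁻¹' K := by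
  intro y hy
  rw [chartPullback, Function.mem_support] at hy
  have h := mem_of_indicator_ne_zero hy
  rw [indicator_of_mem h] at hy
  exact ⟨h, hs hy⟩

lemma continuousOn_chartPullback [T2Space M] (a : M) {F : M → ℂ} {K : Set M} (hK : IsCompact K)
    (hKa : K ⊆ (extChartAt (𝓡∂ (d + 1)) a).source) (hs : Function.support F ⊆ K)
    (hF : ContinuousOn F (extChartAt (𝓡∂ (d + 1)) a).source) :
    ContinuousOn (chartPullback d a F) {y | 0 ≤ y 0} := by
  have hc := isCompact_target_inter_preimage a hK hKa
  intro y hy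
  by_cases hyt : y ∈ (extChartAt (𝓡∂ (d + 1)) a).target
  · have h1 : ContinuousWithinAt (fun y => F ((extChartAt (𝓡∂ (d + 1)) a).symm y))
        (extChartAt (𝓡∂ (d + 1)) a).target y :=
      (hF.comp (continuousOn_extChartAt_symm a) (extChartAt (𝓡∂ (d + 1)) a).mapsTo_symm) y hyt
    have h2 : ContinuousWithinAt (chartPullback d a F) (extChartAt (𝓡∂ (d + 1)) a).target y :=
      h1.congr (fun z hz => indicator_of_mem hz _) (indicator_of_mem hyt _)
    refine h2.mono_of_mem_nhdsWithin ?_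
    have := extChartAt_target_mem_nhdsWithin_of_mem (I := 𝓡∂ (d + 1)) hyt
    rwa [range_modelWithCornersEuclideanHalfSpace] at this
  · have h1 : ((extChartAt (𝓡∂ (d + 1)) a).target ∩
        (extChartAt (𝓡∂ (d + 1)) a).symm ⁻¹' K)ᶜ ∈ 𝓝 y :=
      hc.isClosed.isOpen_compl.mem_nhds fun h => hyt h.1
    have h2 : chartPullback d a F =ᶠ[𝓝 y] fun _ => 0 := by
      filter_upwards [h1] with z hz
      by_contra h
      exact hz (support_chartPullback a hs h)
    exact (continuousAt_const.congr h2.symm).continuousWithinAt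

end Pullback

/-! ### Sections cut off near the boundary -/

section LocalGreen

variable {d m : ℕ} {M : Type*} [TopologicalSpace M]
  [ChartedSpace (EuclideanHalfSpace (d + 1)) M]

/-- The section `φ`, cut off at distance `ε` from the boundary in the preferred chart at `a`. -/
def cutoffSection (d : ℕ) {m : ℕ} {M : Type*} [TopologicalSpace M]
    [ChartedSpace (EuclideanHalfSpace (d + 1)) M] (a : M) (ε : ℝ) (φ : M → Fin m → ℂ) :
    M → Fin m → ℂ :=
  fun x => cutoff (extChartAt (𝓡∂ (d + 1)) a x 0 / ε) • φ x

lemma tsupport_cutoffSection_subset (a : M) (ε : ℝ) (φ : M → Fin m → ℂ) :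
    tsupport (cutoffSection d a ε φ) ⊆ tsupport φ :=
  closure_mono fun x hx h => hx (by simp [cutoffSection, h])

variable [IsManifold (𝓡∂ (d + 1)) ∞ M]

lemma contMDiffAt_cutoff_coord {a x : M} (hx : x ∈ (extChartAt (𝓡∂ (d + 1)) a).source) (ε : ℝ) :
    ContMDiffAt (𝓡∂ (d + 1)) 𝓘(ℝ, ℝ) ∞
      (fun x => cutoff (extChartAt (𝓡∂ (d + 1)) a x 0 / ε)) x := by
  rw [extChartAt_source] at hx
  have h1 : ContMDiffAt (𝓡∂ (d + 1)) 𝓘(ℝ, EuclideanSpace ℝ (Fin (d + 1))) ∞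
      (extChartAt (𝓡∂ (d + 1)) a) x := contMDiffAt_extChartAt' hx
  have h2 : ContDiff ℝ ∞ fun y : EuclideanSpace ℝ (Fin (d + 1)) => cutoff (y 0 / ε) :=
    contDiff_cutoff.comp (by fun_prop)
  exact h2.contDiffAt.contMDiffAt.comp x h1

lemma isSmoothSection_cutoffSection (a : M) (ε : ℝ) {φ : M → Fin m → ℂ}
    (hφ : IsSmoothSection d φ) (hs : tsupport φ ⊆ (extChartAt (𝓡∂ (d + 1)) a).source) :
    IsSmoothSection d (cutoffSection d a ε φ) := by
  refine contMDiff_of_tsupport fun x hx => ?_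
  exact (contMDiffAt_cutoff_coord (hs (tsupport_cutoffSection_subset a ε φ hx)) ε).smul (hφ x)

lemma tsupport_cutoffSection_subset_interior (a : M) {ε : ℝ} (hε : 0 < ε) {φ : M → Fin m → ℂ}
    (hs : tsupport φ ⊆ (extChartAt (𝓡∂ (d + 1)) a).source) :
    tsupport (cutoffSection d a ε φ) ⊆ (𝓡∂ (d + 1)).interior M := by
  intro x hx
  have hxa := hs (tsupport_cutoffSection_subset a ε φ hx)
  rw [mem_interior_iff_chart hxa]
  by_contra h0
  refine notMem_tsupport_iff_eventuallyEq.2 ?_ hx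
  have hc : ContinuousAt (fun x => extChartAt (𝓡∂ (d + 1)) a x 0) x :=
    (EuclideanSpace.proj (𝕜 := ℝ) (0 : Fin (d + 1))).continuous.continuousAt.comp
      (continuousAt_extChartAt' hxa)
  filter_upwards [hc.eventually_lt_const (show _ < ε by linarith)] with y hy
  change cutoff (extChartAt (𝓡∂ (d + 1)) a y 0 / ε) • φ y = 0
  rw [cutoff_eq_zero ((div_le_one hε).2 hy.le), zero_smul]

/-- The differential of `χ(y₀ / ε)` is `ε⁻¹ χ'(y₀ / ε) dy₀`. -/
lemma exists_hasMFDerivAt_cutoff_coord {a x : M} (hx : x ∈ (extChartAt (𝓡∂ (d + 1)) a).source)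
    (ε : ℝ) : ∃ h' : TangentSpace (𝓡∂ (d + 1)) x →L[ℝ] ℝ,
      HasMFDerivAt (𝓡∂ (d + 1)) 𝓘(ℝ, ℝ)
        (fun x => cutoff (extChartAt (𝓡∂ (d + 1)) a x 0 / ε)) x h' ∧
      ∀ j, h' (chartFrame a x j) =
        ε⁻¹ * deriv cutoff (extChartAt (𝓡∂ (d + 1)) a x 0 / ε) * if j = 0 then 1 else 0 := by
  have hx' := hx
  rw [extChartAt_source] at hx'
  have h1 : HasMFDerivAt (𝓡∂ (d + 1)) 𝓘(ℝ, EuclideanSpace ℝ (Fin (d + 1)))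
      (extChartAt (𝓡∂ (d + 1)) a) x (tangentCoordChange (𝓡∂ (d + 1)) x a x) := by
    have h0 := hasMFDerivAt_extChartAt (I := 𝓡∂ (d + 1)) hx'
    rwa [mfderiv_chartAt_eq_tangentCoordChange (I := 𝓡∂ (d + 1)) hx'] at h0
  have h2 : HasFDerivAt (fun y : EuclideanSpace ℝ (Fin (d + 1)) => cutoff (y 0 / ε))
      (deriv cutoff (extChartAt (𝓡∂ (d + 1)) a x 0 / ε) • (ε⁻¹ •
        (EuclideanSpace.proj (𝕜 := ℝ) (0 : Fin (d + 1))))) (extChartAt (𝓡∂ (d + 1)) a x) := by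
    have h3 : HasFDerivAt (fun y : EuclideanSpace ℝ (Fin (d + 1)) => y 0 / ε)
        (ε⁻¹ • (EuclideanSpace.proj (𝕜 := ℝ) (0 : Fin (d + 1))))
        (extChartAt (𝓡∂ (d + 1)) a x) := by
      simp only [div_eq_inv_mul]
      exact ((EuclideanSpace.proj (𝕜 := ℝ) (0 : Fin (d + 1))).hasFDerivAt).const_mul _
    exact ((contDiff_cutoff.differentiable (by simp)).differentiableAt.hasDerivAt).comp_hasFDerivAt
      _ h3
  have h4 := HasMFDerivAt.comp x h2.hasMFDerivAt h1
  refine ⟨_, h4, fun j => ?_⟩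
  have h5 : tangentCoordChange (𝓡∂ (d + 1)) x a x (tangentCoordChange (𝓡∂ (d + 1)) a x x
      (EuclideanSpace.single j (1 : ℝ))) = EuclideanSpace.single j (1 : ℝ) := by
    rw [tangentCoordChange_comp ⟨⟨hx, mem_extChartAt_source x⟩, hx⟩, tangentCoordChange_self hx]
  refine (congrArg (fun v : EuclideanSpace ℝ (Fin (d + 1)) =>
    deriv cutoff (extChartAt (𝓡∂ (d + 1)) a x 0 / ε) * (ε⁻¹ * v 0)) h5).trans ?_
  rw [PiLp.single_apply]
  simp only [eq_comm (a := (0 : Fin (d + 1)))]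
  ring

variable (g : Metric d M)

/-- The coefficient `g^{i0} ⟨αᵢ, φ⟩` of `dy₀` in the pairing of `α` with `dy₀ ⊗ φ`. -/
def conormalPairing (a : M) (α : ∀ x : M, TangentSpace (𝓡∂ (d + 1)) x →L[ℝ] (Fin m → ℂ))
    (φ : M → Fin m → ℂ) (x : M) : ℂ :=
  ∑ i, ((chartGram g a x)⁻¹ i 0 : ℂ) * herm (α x (chartFrame a x i)) (φ x)

/-- The product rule for `χ(y₀ / ε) φ`, paired with `α`. -/
lemma vecFormInner_cutoffSection (A : Matrix (Fin m) (Fin m) (OneForm d M)) {a x : M}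
    (hx : x ∈ (extChartAt (𝓡∂ (d + 1)) a).source)
    (α : ∀ x : M, TangentSpace (𝓡∂ (d + 1)) x →L[ℝ] (Fin m → ℂ)) {φ : M → Fin m → ℂ}
    (hφ : IsSmoothSection d φ) (ε : ℝ) :
    vecFormInner g x (α x) (covDeriv A (cutoffSection d a ε φ) x)
      = (cutoff (extChartAt (𝓡∂ (d + 1)) a x 0 / ε) : ℂ)
          * vecFormInner g x (α x) (covDeriv A φ x)
        + ((ε⁻¹ * deriv cutoff (extChartAt (𝓡∂ (d + 1)) a x 0 / ε) : ℝ) : ℂ)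
          * conormalPairing g a α φ x := by
  obtain ⟨h', hh, hj⟩ := exists_hasMFDerivAt_cutoff_coord hx ε
  rw [vecFormInner_eq_chart g hx, vecFormInner_eq_chart g hx]
  simp only [chartVecFormInner, conormalPairing, Finset.mul_sum]
  rw [← Finset.sum_add_distrib]
  refine Finset.sum_congr rfl fun i _ => ?_
  have h1 : ∀ j, herm (α x (chartFrame a x i))
      (covDeriv A (cutoffSection d a ε φ) x (chartFrame a x j))
      = (cutoff (extChartAt (𝓡∂ (d + 1)) a x 0 / ε) : ℂ)
          * herm (α x (chartFrame a x i)) (covDeriv A φ x (chartFrame a x j))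
        + if j = 0 then ((ε⁻¹ * deriv cutoff (extChartAt (𝓡∂ (d + 1)) a x 0 / ε) : ℝ) : ℂ)
          * herm (α x (chartFrame a x i)) (φ x) else 0 := by
    intro j
    have := covDeriv_smul A hh (hφ.mdifferentiableAt x) (chartFrame a x j)
    rw [show covDeriv A (cutoffSection d a ε φ) x (chartFrame a x j) = _ from this,
      herm_add_right, herm_smul_right, herm_smul_right, hj j]
    split_ifs <;> simp
  simp only [h1, mul_add, Finset.sum_add_distrib, mul_ite, mul_zero, Finset.sum_ite_eq',
    Finset.mem_univ, if_true]
  congr 1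
  · exact Finset.sum_congr rfl fun j _ => by ring
  · ring

lemma continuousOn_conormalPairing (a : M)
    {α : ∀ x : M, TangentSpace (𝓡∂ (d + 1)) x →L[ℝ] (Fin m → ℂ)} (hα : ContinuousForm α)
    {φ : M → Fin m → ℂ} (hφ : Continuous φ) :
    ContinuousOn (conormalPairing g a α φ) (extChartAt (𝓡∂ (d + 1)) a).source :=
  continuousOn_finsetSum _ fun i _ => (continuousOn_inv_chartGram_apply g a i 0).mul
    (continuousOn_herm (hα a i) hφ.continuousOn)

lemma herm_outwardNormal {a x : M} (ha : x ∈ (extChartAt (𝓡∂ (d + 1)) a).source)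
    (hx : x ∈ (𝓡∂ (d + 1)).boundary M)
    (α : ∀ x : M, TangentSpace (𝓡∂ (d + 1)) x →L[ℝ] (Fin m → ℂ)) (φ : M → Fin m → ℂ) :
    herm (α x (outwardNormal g x)) (φ x)
      = -((Real.sqrt ((chartGram g a x)⁻¹ 0 0))⁻¹ : ℝ) * conormalPairing g a α φ x := by
  rw [outwardNormal_eq_chart g ha hx, map_sum, herm_sum_left, conormalPairing, Finset.mul_sum]
  refine Finset.sum_congr rfl fun i _ => ?_
  rw [map_smul, herm_smul_left]
  push_cast
  ring

lemma continuousOn_normal_factor (a : M) :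
    ContinuousOn (fun x => (((Real.sqrt ((chartGram g a x)⁻¹ 0 0))⁻¹ : ℝ) : ℂ))
      (extChartAt (𝓡∂ (d + 1)) a).source := by
  refine Complex.continuous_ofReal.comp_continuousOn (ContinuousOn.inv₀
    (Real.continuous_sqrt.comp_continuousOn
      (continuousOn_pi.1 (continuousOn_pi.1 (continuousOn_inv_chartGram g a) 0) 0)) fun x hx => ?_)
  exact (Real.sqrt_pos.2 (chartGram_posDef g hx).inv.diag_pos).ne'

end LocalGreen

/-! ### Green's formula in one chart -/

section LocalGreen

variable {d m : ℕ} {M : Type*} [TopologicalSpace M]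
  [ChartedSpace (EuclideanHalfSpace (d + 1)) M]

lemma covDeriv_eq_zero_of_notMem_tsupport (A : Matrix (Fin m) (Fin m) (OneForm d M))
    {φ : M → Fin m → ℂ} {x : M} (hx : x ∉ tsupport φ) : covDeriv A φ x = 0 := by
  have h := notMem_tsupport_iff_eventuallyEq.1 hx
  have h1 : sectionDeriv d φ x = 0 := by
    rw [sectionDeriv, h.mfderiv_eq]
    exact mfderiv_const
  ext X k
  rw [covDeriv_apply, h1, h.eq_of_nhds]
  simp

variable [IsManifold (𝓡∂ (d + 1)) ∞ M] (g : Metric d M)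

lemma support_greenIntegrand_subset (A : Matrix (Fin m) (Fin m) (OneForm d M))
    (α : ∀ x : M, TangentSpace (𝓡∂ (d + 1)) x →L[ℝ] (Fin m → ℂ)) (β φ : M → Fin m → ℂ) :
    Function.support (fun x => vecFormInner g x (α x) (covDeriv A φ x) - herm (β x) (φ x))
      ⊆ tsupport φ := by
  intro x hx
  by_contra h
  refine hx ?_
  have h0 : φ x = 0 := image_eq_zero_of_notMem_tsupport h
  simp [covDeriv_eq_zero_of_notMem_tsupport A h, h0, vecFormInner, herm_zero_right]

lemma support_conormalPairing_subset (a : M)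
    (α : ∀ x : M, TangentSpace (𝓡∂ (d + 1)) x →L[ℝ] (Fin m → ℂ)) (φ : M → Fin m → ℂ) :
    Function.support (conormalPairing g a α φ) ⊆ tsupport φ := by
  intro x hx
  by_contra h
  refine hx ?_
  have h0 : φ x = 0 := image_eq_zero_of_notMem_tsupport h
  simp [conormalPairing, h0, herm_zero_right]

variable [MeasurableSpace M] [BorelSpace M]

/-- On the boundary, contraction with the outward normal is a multiple of the conormal pairing,
which is continuous on the whole chart domain. -/
lemma herm_outwardNormal_ae (a : M) (α : ∀ x : M, TangentSpace (𝓡∂ (d + 1)) x →L[ℝ] (Fin m → ℂ))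
    (φ : M → Fin m → ℂ) :
    (fun x => herm (α x (outwardNormal g x)) (φ x)) =ᵐ[chartSurface g a]
      fun x => -((Real.sqrt ((chartGram g a x)⁻¹ 0 0))⁻¹ : ℝ) * conormalPairing g a α φ x := by
  have h : ∀ᵐ x ∂(chartSurface g a),
      x ∈ (extChartAt (𝓡∂ (d + 1)) a).source ∩ (𝓡∂ (d + 1)).boundary M :=
    chartSurface_compl g a
  filter_upwards [h] with x hx using herm_outwardNormal g hx.1 hx.2 α φ

lemma integral_herm_outwardNormal (a : M)
    {α : ∀ x : M, TangentSpace (𝓡∂ (d + 1)) x →L[ℝ] (Fin m → ℂ)} (hα : ContinuousForm α)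
    {φ : M → Fin m → ℂ} (hφ : Continuous φ) :
    ∫ x, herm (α x (outwardNormal g x)) (φ x) ∂(chartSurface g a)
      = -∫ z, chartPullback d a (fun x => (Real.sqrt (chartGram g a x).det : ℂ)
          * conormalPairing g a α φ x) (boundaryIncl z) := by
  rw [integral_congr_ae (herm_outwardNormal_ae g a α φ), integral_chartSurface g a
    (F := fun x => -((Real.sqrt ((chartGram g a x)⁻¹ 0 0))⁻¹ : ℝ) * conormalPairing g a α φ x)
    ((continuousOn_normal_factor g a).neg.mul (continuousOn_conormalPairing g a hα hφ)),
    ← integral_indicator (measurableSet_boundaryTarget a), ← integral_neg]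
  refine integral_congr_ae (Eventually.of_forall fun z => ?_)
  by_cases hz : z ∈ boundaryTarget d a
  · have hz' : boundaryIncl z ∈ (extChartAt (𝓡∂ (d + 1)) a).target := hz
    have hG := chartGram_posDef g (mapsTo_boundaryTarget a hz).1
    have h0 : Real.sqrt ((chartGram g a ((extChartAt (𝓡∂ (d + 1)) a).symm
      (boundaryIncl z)))⁻¹ 0 0) ≠ 0 := (Real.sqrt_pos.2 hG.inv.diag_pos).ne'
    change (boundaryTarget d a).indicator _ z = -(chartPullback d a _ (boundaryIncl z))
    rw [indicator_of_mem hz, chartPullback, indicator_of_mem hz', ← sqrt_det_mul_sqrt_inv hG]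
    rw [Complex.ofReal_mul, Complex.ofReal_inv]
    have h1 := Complex.ofReal_ne_zero.2 h0
    field_simp
  · change (boundaryTarget d a).indicator _ z = -(chartPullback d a _ (boundaryIncl z))
    have hz' : boundaryIncl z ∉ (extChartAt (𝓡∂ (d + 1)) a).target := hz
    rw [indicator_of_notMem hz, chartPullback, indicator_of_notMem hz', neg_zero]

variable [T2Space M]

lemma integrable_herm_outwardNormal (a : M)
    {α : ∀ x : M, TangentSpace (𝓡∂ (d + 1)) x →L[ℝ] (Fin m → ℂ)} (hα : ContinuousForm α)
    {φ : M → Fin m → ℂ} (hφ : Continuous φ) (hK : IsCompact (tsupport φ))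
    (hs : tsupport φ ⊆ (extChartAt (𝓡∂ (d + 1)) a).source) :
    Integrable (fun x => herm (α x (outwardNormal g x)) (φ x)) (chartSurface g a) := by
  refine Integrable.congr ?_ (herm_outwardNormal_ae g a α φ).symm
  refine integrable_chartSurface g a
    ((continuousOn_normal_factor g a).neg.mul (continuousOn_conormalPairing g a hα hφ)) hK hs ?_
  exact (Function.support_mul_subset_right _ _).trans (support_conormalPairing_subset g a α φ)

variable [CompactSpace M]

lemma integral_chartPullback (a : M) {W : M → ℂ} (hW : Continuous W)
    (hs : Function.support W ⊆ (extChartAt (𝓡∂ (d + 1)) a).source) :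
    ∫ y, chartPullback d a (fun x => (Real.sqrt (chartGram g a x).det : ℂ) * W x) y
      = ∫ x, W x ∂(volumeMeasure g) := by
  rw [integral_volumeMeasure_of_support g a hW.continuousOn hs]
  exact integral_indicator (measurableSet_extChartAt_target a)

/-- Green's formula for sections supported in the domain of one chart. -/
lemma green_of_tsupport_subset {A : Matrix (Fin m) (Fin m) (OneForm d M)}
    (hA : ∀ k l, OneForm.IsSmooth (A k l))
    {α : ∀ x : M, TangentSpace (𝓡∂ (d + 1)) x →L[ℝ] (Fin m → ℂ)} (hα : ContinuousForm α)
    {β : M → Fin m → ℂ} (hβ : Continuous β) (h : IsFormalAdjoint g A α β) (a : M)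
    {φ : M → Fin m → ℂ} (hφ : IsSmoothSection d φ)
    (hs : tsupport φ ⊆ (extChartAt (𝓡∂ (d + 1)) a).source) :
    ∫ x, (vecFormInner g x (α x) (covDeriv A φ x) - herm (β x) (φ x)) ∂(volumeMeasure g)
      = ∫ x, herm (α x (outwardNormal g x)) (φ x) ∂(chartSurface g a) := by
  have hK : IsCompact (tsupport φ) := (isClosed_tsupport φ).isCompact
  have hcont : ∀ ψ : M → Fin m → ℂ, IsSmoothSection d ψ →
      Continuous fun x => vecFormInner g x (α x) (covDeriv A ψ x) := fun ψ hψ =>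
    continuous_vecFormInner g hα (continuousForm_covDeriv hA hψ)
  have hcont' : ∀ ψ : M → Fin m → ℂ, IsSmoothSection d ψ →
      Continuous fun x => herm (β x) (ψ x) := fun ψ hψ =>
    continuousOn_univ.1 (continuousOn_herm hβ.continuousOn hψ.continuous.continuousOn)
  set W : M → ℂ := fun x => vecFormInner g x (α x) (covDeriv A φ x) - herm (β x) (φ x) with hW
  have hWc : Continuous W := (hcont φ hφ).sub (hcont' φ hφ)
  have hWs : Function.support W ⊆ tsupport φ := support_greenIntegrand_subset g A α β φ
  set D : M → ℂ := fun x => (Real.sqrt (chartGram g a x).det : ℂ) with hD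
  have hDc : ContinuousOn D (extChartAt (𝓡∂ (d + 1)) a).source :=
    Complex.continuous_ofReal.comp_continuousOn (continuousOn_sqrt_det_chartGram g a)
  set w := chartPullback d a (fun x => D x * W x)
  set n := chartPullback d a (fun x => D x * conormalPairing g a α φ x)
  have hc := isCompact_target_inter_preimage a hK hs
  have hH : (extChartAt (𝓡∂ (d + 1)) a).target ∩ (extChartAt (𝓡∂ (d + 1)) a).symm ⁻¹' tsupport φ
      ⊆ {y | 0 ≤ y 0} := inter_subset_left.trans (extChartAt_target_subset_halfSpace a)
  have hsW : Function.support (fun x => D x * W x) ⊆ tsupport φ :=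
    (Function.support_mul_subset_right _ _).trans hWs
  have hsN : Function.support (fun x => D x * conormalPairing g a α φ x) ⊆ tsupport φ :=
    (Function.support_mul_subset_right _ _).trans (support_conormalPairing_subset g a α φ)
  have hwc := continuousOn_chartPullback a hK hs hsW (hDc.mul hWc.continuousOn)
  have hnc := continuousOn_chartPullback a hK hs hsN
    (hDc.mul (continuousOn_conormalPairing g a hα hφ.continuous))
  have hws := support_chartPullback (d := d) a hsW
  have hns := support_chartPullback (d := d) a hsN
  have hint : ∀ (c : EuclideanSpace ℝ (Fin (d + 1)) → ℂ) (p : EuclideanSpace ℝ (Fin (d + 1)) → ℂ),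
      Continuous c → ContinuousOn p {y | 0 ≤ y 0} →
      Function.support p ⊆ (extChartAt (𝓡∂ (d + 1)) a).target ∩
        (extChartAt (𝓡∂ (d + 1)) a).symm ⁻¹' tsupport φ → Integrable fun y => c y * p y :=
    fun c p hcc hp hps => integrable_of_continuousOn_compact hc hH (hcc.continuousOn.mul hp)
      ((Function.support_mul_subset_right _ _).trans hps) hc.measure_lt_top
  -- The formal adjoint identity for the cut-off section, in coordinates.
  have key : ∀ ε : ℝ, 0 < ε → (∫ y, (cutoff (y 0 / ε) : ℂ) * w y)
      + ∫ y, ((ε⁻¹ * deriv cutoff (y 0 / ε) : ℝ) : ℂ) * n y = 0 := by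
    intro ε hε
    have hcs := isSmoothSection_cutoffSection a ε hφ hs
    have h1 := h (cutoffSection d a ε φ) hcs (isClosed_tsupport _).isCompact
      (tsupport_cutoffSection_subset_interior a hε hs)
    have h2 := integral_sub (integrable_volumeMeasure g (hcont _ hcs))
      (integrable_volumeMeasure g (hcont' _ hcs))
    rw [← h1, sub_self, integral_volumeMeasure_of_support g a
      (F := fun x => vecFormInner g x (α x) (covDeriv A (cutoffSection d a ε φ) x)
        - herm (β x) (cutoffSection d a ε φ x))
      ((hcont _ hcs).sub (hcont' _ hcs)).continuousOn
      ((support_greenIntegrand_subset g A α β _).trans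
        ((tsupport_cutoffSection_subset a ε φ).trans hs)),
      ← integral_indicator (measurableSet_extChartAt_target a)] at h2
    rw [← h2, ← integral_add (hint _ _ ?_ hwc hws) (hint _ _ ?_ hnc hns)]
    · refine integral_congr_ae (Eventually.of_forall fun y => ?_)
      by_cases hy : y ∈ (extChartAt (𝓡∂ (d + 1)) a).target
      · have hy' := (extChartAt (𝓡∂ (d + 1)) a).map_target hy
        have hyy := (extChartAt (𝓡∂ (d + 1)) a).right_inv hy
        have hcf : ∀ x, herm (β x) (cutoffSection d a ε φ x)
            = (cutoff (extChartAt (𝓡∂ (d + 1)) a x 0 / ε) : ℂ) * herm (β x) (φ x) :=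
          fun x => herm_smul_right _ _ _
        beta_reduce
        rw [indicator_of_mem hy, chartPullback, chartPullback, indicator_of_mem hy,
          indicator_of_mem hy, vecFormInner_cutoffSection g A hy' α hφ, hcf, hyy]
        ring
      · beta_reduce
        rw [indicator_of_notMem hy, chartPullback, chartPullback, indicator_of_notMem hy,
          indicator_of_notMem hy]
        simp
    · exact Complex.continuous_ofReal.comp (contDiff_cutoff.continuous.comp (by fun_prop))
    · exact Complex.continuous_ofReal.comp (continuous_const.mul
        (continuous_deriv_cutoff.comp (by fun_prop)))
  have hwi : Integrable w := integrable_of_continuousOn_compact hc hH hwc hws hc.measure_lt_top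
  have hw0 : ∀ y, y 0 < 0 → w y = 0 := fun y hy => by
    by_contra h0
    exact absurd (hH (hws h0)) (not_le.2 hy)
  have hlim := (tendsto_integral_cutoff hwi hw0).add
    (tendsto_integral_deriv_cutoff hc hH hnc hns)
  have hzero := tendsto_nhds_unique hlim (tendsto_const_nhds.congr'
    (eventually_mem_nhdsWithin.mono fun ε hε => (key ε hε).symm))
  rw [integral_herm_outwardNormal g a hα hφ.continuous,
    ← integral_chartPullback g a hWc (hWs.trans hs)]
  exact eq_neg_of_add_eq_zero_left hzero

end LocalGreen

/-! ### Green's formula on the manifold -/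

section Green

variable {d m : ℕ} {M : Type*} [TopologicalSpace M]
  [ChartedSpace (EuclideanHalfSpace (d + 1)) M]

lemma herm_sum_right {ι : Type*} (s : Finset ι) (a : Fin m → ℂ) (b : ι → Fin m → ℂ) :
    herm a (∑ i ∈ s, b i) = ∑ i ∈ s, herm a (b i) := by
  rw [← conj_herm, herm_sum_left, map_sum]
  simp only [conj_herm]

lemma covDeriv_sum (A : Matrix (Fin m) (Fin m) (OneForm d M)) {ι : Type*} (s : Finset ι)
    {φ : ι → M → Fin m → ℂ} {x : M}
    (hφ : ∀ i, MDifferentiableAt (𝓡∂ (d + 1)) 𝓘(ℝ, Fin m → ℂ) (φ i) x)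
    (X : TangentSpace (𝓡∂ (d + 1)) x) :
    covDeriv A (fun y => ∑ i ∈ s, φ i y) x X = ∑ i ∈ s, covDeriv A (φ i) x X := by
  suffices h : MDifferentiableAt (𝓡∂ (d + 1)) 𝓘(ℝ, Fin m → ℂ) (fun y => ∑ i ∈ s, φ i y) x ∧
      covDeriv A (fun y => ∑ i ∈ s, φ i y) x X = ∑ i ∈ s, covDeriv A (φ i) x X from h.2
  classical
  induction s using Finset.induction_on with
  | empty =>
    refine ⟨mdifferentiableAt_const, ?_⟩
    rw [covDeriv_eq_zero_of_notMem_tsupport A (by simp)]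
    rfl
  | insert i s hi ih =>
    simp only [Finset.sum_insert hi]
    refine ⟨(hφ i).add ih.1, ?_⟩
    rw [covDeriv_add A (hφ i) ih.1, add_apply, ih.2]

variable [IsManifold (𝓡∂ (d + 1)) ∞ M] (g : Metric d M)

variable [T2Space M] [MeasurableSpace M] [BorelSpace M] [CompactSpace M]

/-- The section `ρₐ φ`, for the member `ρₐ` of the partition of unity. -/
def localizedSection (d : ℕ) {m : ℕ} {M : Type*} [TopologicalSpace M]
    [ChartedSpace (EuclideanHalfSpace (d + 1)) M] [IsManifold (𝓡∂ (d + 1)) ∞ M]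
    [T2Space M] [SigmaCompactSpace M] (a : M) (φ : M → Fin m → ℂ) : M → Fin m → ℂ :=
  fun x => chartPartition d M a x • φ x

omit [MeasurableSpace M] [BorelSpace M] in
lemma tsupport_localizedSection_subset (a : M) (φ : M → Fin m → ℂ) :
    tsupport (localizedSection d a φ) ⊆ (extChartAt (𝓡∂ (d + 1)) a).source := by
  refine subset_trans (closure_mono fun x hx (h : chartPartition d M a x = 0) => hx ?_)
    (tsupport_chartPartition_subset a)
  change chartPartition d M a x • φ x = 0
  rw [h, zero_smul]

/-- The boundary integrand is integrable, although the normal is not extended to a continuous field: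
after localization it agrees on the boundary with a continuous function. -/
lemma integrable_boundary {α : ∀ x : M, TangentSpace (𝓡∂ (d + 1)) x →L[ℝ] (Fin m → ℂ)}
    (hα : ContinuousForm α) {φ : M → Fin m → ℂ} (hφ : Continuous φ) (a : M) :
    Integrable (fun x => (chartPartition d M a x : ℂ) * herm (α x (outwardNormal g x)) (φ x))
      (chartSurface g a) := by
  have h := integrable_herm_outwardNormal g a hα
    (φ := localizedSection d a φ) ((chartPartition d M a).contMDiff.continuous.smul hφ)
    (isClosed_tsupport _).isCompact (tsupport_localizedSection_subset a φ)
  refine h.congr (Eventually.of_forall fun x => ?_)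
  exact herm_smul_right _ _ _

/-- **Green's formula**: if `β = d_A^* α`, then `(α, d_A φ) - (β, φ)` is the boundary integral of
`⟨α(ν), φ⟩`, for every smooth `φ`. -/
theorem green {A : Matrix (Fin m) (Fin m) (OneForm d M)}
    (hA : ∀ k l, OneForm.IsSmooth (A k l))
    {α : ∀ x : M, TangentSpace (𝓡∂ (d + 1)) x →L[ℝ] (Fin m → ℂ)} (hα : ContinuousForm α)
    {β : M → Fin m → ℂ} (hβ : Continuous β) (h : IsFormalAdjoint g A α β)
    {φ : M → Fin m → ℂ} (hφ : IsSmoothSection d φ) :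
    ∫ p : (𝓡∂ (d + 1)).boundary M, herm (α p (outwardNormal g p)) (φ p) ∂(surfaceMeasure g)
      = ∫ x, (vecFormInner g x (α x) (covDeriv A φ x) - herm (β x) (φ x)) ∂(volumeMeasure g) := by
  have hsm : ∀ a, IsSmoothSection d (localizedSection d a φ) := fun a =>
    ((chartPartition d M a).contMDiff).smul hφ
  have hφs : φ = fun x => ∑ a ∈ (finite_chartPartition_support d M).toFinset,
      localizedSection d a φ x := by
    funext x
    simp only [localizedSection]
    rw [← Finset.sum_smul, sum_chartPartition, one_smul]
  rw [integral_surfaceMeasure g (ψ := fun x => herm (α x (outwardNormal g x)) (φ x))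
    (integrable_boundary g hα hφ.continuous)]
  have h1 : ∀ a, ∫ x, (chartPartition d M a x : ℂ) * herm (α x (outwardNormal g x)) (φ x)
      ∂(chartSurface g a) = ∫ x, (vecFormInner g x (α x) (covDeriv A (localizedSection d a φ) x)
        - herm (β x) (localizedSection d a φ x)) ∂(volumeMeasure g) := fun a => by
    rw [green_of_tsupport_subset g hA hα hβ h a (hsm a) (tsupport_localizedSection_subset a φ)]
    exact integral_congr_ae (Eventually.of_forall fun x => (herm_smul_right _ _ _).symm)
  simp only [h1]
  rw [← integral_finsetSum]
  · refine integral_congr_ae (Eventually.of_forall fun x => ?_)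
    have h2 : ∀ X, covDeriv A φ x X = ∑ a ∈ (finite_chartPartition_support d M).toFinset,
        covDeriv A (localizedSection d a φ) x X := fun X => by
      conv_lhs => rw [hφs]
      exact covDeriv_sum A _ (fun a => (hsm a).mdifferentiableAt x) X
    have h3 : φ x = ∑ a ∈ (finite_chartPartition_support d M).toFinset,
      localizedSection d a φ x := congrFun hφs x
    beta_reduce
    rw [Finset.sum_sub_distrib, h3, herm_sum_right]
    congr 1
    simp only [vecFormInner, h2, herm_sum_right, Finset.mul_sum]
    rw [Finset.sum_comm]
    refine Finset.sum_congr rfl fun i _ => Finset.sum_comm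
  · intro a _
    refine (integrable_volumeMeasure g ?_)
    exact (continuous_vecFormInner g hα (continuousForm_covDeriv hA (hsm a))).sub
      (continuousOn_univ.1 (continuousOn_herm hβ.continuousOn (hsm a).continuous.continuousOn))

end Green

/-! ### Unitary connections and the first-order term -/

section Algebra

variable {d m : ℕ} {M : Type*} [TopologicalSpace M]
  [ChartedSpace (EuclideanHalfSpace (d + 1)) M]

lemma herm_mulVec_left (P : Matrix (Fin m) (Fin m) ℂ) (a b : Fin m → ℂ) :
    herm (P *ᵥ a) b = ∑ k, ∑ l, P k l * (a l * conj (b k)) := by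
  simp only [herm, Matrix.mulVec, dotProduct, Finset.sum_mul, mul_assoc]

lemma herm_mulVec_right (P : Matrix (Fin m) (Fin m) ℂ) (a b : Fin m → ℂ) :
    herm a (P *ᵥ b) = herm (Pᴴ *ᵥ a) b := by
  rw [← conj_herm, herm_mulVec_left, herm_mulVec_left, Finset.sum_comm]
  simp only [map_sum, map_mul, Complex.conj_conj, Matrix.conjTranspose_apply, RCLike.star_def]
  exact Finset.sum_congr rfl fun _ _ => Finset.sum_congr rfl fun _ _ => by ring

lemma continuous_herm {X : Type*} [TopologicalSpace X] {u v : X → Fin m → ℂ}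
    (hu : Continuous u) (hv : Continuous v) :
    Continuous fun x => herm (u x) (v x) :=
  continuousOn_univ.1 (continuousOn_herm hu.continuousOn hv.continuousOn)

lemma differential_apply {u : M → Fin m → ℂ} (hu : IsSmoothSection d u) (x : M)
    (X : TangentSpace (𝓡∂ (d + 1)) x) (k : Fin m) :
    differential d (fun y => u y k) x X = sectionDeriv d u x X k := by
  have h := ((ContinuousLinearMap.proj (R := ℝ) (φ := fun _ : Fin m => ℂ) k).hasMFDerivAt
    (x := u x)).comp x (hu.mdifferentiableAt x).hasMFDerivAt
  exact congrArg (fun L : TangentSpace (𝓡∂ (d + 1)) x →L[ℝ] ℂ => L X) h.mfderiv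

lemma differential_conj_apply {u : M → Fin m → ℂ} (hu : IsSmoothSection d u) (x : M)
    (X : TangentSpace (𝓡∂ (d + 1)) x) (k : Fin m) :
    differential d (fun y => conj (u y k)) x X = conj (sectionDeriv d u x X k) := by
  have h := (((Complex.conjCLE : ℂ →L[ℝ] ℂ).comp
    (ContinuousLinearMap.proj (R := ℝ) (φ := fun _ : Fin m => ℂ) k)).hasMFDerivAt
    (x := u x)).comp x (hu.mdifferentiableAt x).hasMFDerivAt
  exact congrArg (fun L : TangentSpace (𝓡∂ (d + 1)) x →L[ℝ] ℂ => L X) h.mfderiv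

lemma covDeriv_frame (A : Matrix (Fin m) (Fin m) (OneForm d M)) (u : M → Fin m → ℂ) (x : M)
    (i : Fin (d + 1)) :
    covDeriv A u x (frame x i) = sectionDeriv d u x (frame x i) + component A x i *ᵥ u x := by
  ext k
  rw [covDeriv_apply]
  rfl

lemma continuous_potential {Q : M → Matrix (Fin m) (Fin m) ℂ} (hQ : IsSmoothPotential d Q)
    {u : M → Fin m → ℂ} (hu : IsSmoothSection d u) : Continuous fun x => Q x *ᵥ u x :=
  continuous_pi fun k => show Continuous fun x => ∑ l, Q x k l * u x l from
    continuous_finsetSum _ fun l _ =>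
      (hQ k l).continuous.mul ((continuous_apply l).comp hu.continuous)

variable [IsManifold (𝓡∂ (d + 1)) ∞ M]

/-- A unitary connection is given by a skew-Hermitian matrix of one-forms. -/
lemma IsUnitaryConnection.conj_apply {A : Matrix (Fin m) (Fin m) (OneForm d M)}
    (hA : IsUnitaryConnection A) (k l : Fin m) (x : M) (X : TangentSpace (𝓡∂ (d + 1)) x) :
    conj (A l k x X) = -A k l x X := by
  classical
  have hc : ∀ c : Fin m → ℂ, sectionDeriv d (fun _ : M => c) x = 0 := fun c => mfderiv_const
  have hcov : ∀ p q : Fin m, covDeriv A (fun _ => Pi.single p (1 : ℂ)) x X q = A q p x X := by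
    intro p q
    rw [covDeriv_apply, hc]
    simp [Pi.single_apply]
  have h := hA.metric (fun _ => Pi.single l 1) (fun _ => Pi.single k 1) contMDiff_const
    contMDiff_const x X
  have h0 : differential d (fun _ : M => herm (Pi.single l (1 : ℂ)) (Pi.single k (1 : ℂ))) x X
      = 0 := by
    rw [differential, mfderiv_const]; rfl
  rw [h0] at h
  have h1 : herm (covDeriv A (fun _ => Pi.single l (1 : ℂ)) x X) (Pi.single k 1) = A k l x X := by
    rw [herm, Finset.sum_eq_single k]
    · simp [hcov]
    · intro b _ hb
      simp [hb]
    · simp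
  have h2 : herm (Pi.single l (1 : ℂ)) (covDeriv A (fun _ => Pi.single k (1 : ℂ)) x X)
      = conj (A l k x X) := by
    rw [herm, Finset.sum_eq_single l]
    · simp [hcov]
    · intro b _ hb
      simp [hb]
    · simp
  rw [h1, h2] at h
  exact eq_neg_of_add_eq_zero_right h.symm

lemma IsUnitaryConnection.conjTranspose_component {A : Matrix (Fin m) (Fin m) (OneForm d M)}
    (hA : IsUnitaryConnection A) (x : M) (i : Fin (d + 1)) :
    (component A x i)ᴴ = -component A x i := by
  ext k l
  exact hA.conj_apply k l x (frame x i)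

variable (g : Metric d M)

lemma invGram_symm (x : M) (i j : Fin (d + 1)) : invGram g x i j = invGram g x j i := by
  have h := (gram_posDef g x).inv.isHermitian
  have := congrFun (congrFun h j) i
  rw [Matrix.conjTranspose_apply] at this
  simpa [invGram] using this

lemma sum_invGram_symm (x : M) (F : Fin (d + 1) → Fin (d + 1) → ℂ) :
    ∑ i, ∑ j, (invGram g x i j : ℂ) * F i j = ∑ i, ∑ j, (invGram g x i j : ℂ) * F j i := by
  rw [Finset.sum_comm]
  exact Finset.sum_congr rfl fun i _ => Finset.sum_congr rfl fun j _ => by rw [invGram_symm]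

lemma conj_vecFormInner (x : M) (α β : TangentSpace (𝓡∂ (d + 1)) x →L[ℝ] (Fin m → ℂ)) :
    conj (vecFormInner g x α β) = vecFormInner g x β α := by
  unfold vecFormInner
  rw [sum_invGram_symm]
  simp [map_sum, conj_herm]

lemma vecFormInner_sub_left (x : M) (α α' β : TangentSpace (𝓡∂ (d + 1)) x →L[ℝ] (Fin m → ℂ)) :
    vecFormInner g x (α - α') β = vecFormInner g x α β - vecFormInner g x α' β := by
  simp only [vecFormInner, sub_apply, herm_sub_left, mul_sub, Finset.sum_sub_distrib]

/-- The first-order term `g^{ij} (⟨Cⱼ u, ∂ᵢ v⟩ - ⟨Cⱼ ∂ᵢ u, v⟩)`, for given matrices `Cⱼ`. -/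
def currentTerm (x : M) (C : Fin (d + 1) → Matrix (Fin m) (Fin m) ℂ) (u v : M → Fin m → ℂ) : ℂ :=
  ∑ i, ∑ j, (invGram g x i j : ℂ) * (herm (C j *ᵥ u x) (sectionDeriv d v x (frame x i))
    - herm (C j *ᵥ sectionDeriv d u x (frame x i)) (v x))

lemma currentTerm_eq_sum {u v : M → Fin m → ℂ} (hu : IsSmoothSection d u)
    (hv : IsSmoothSection d v) (x : M) (C : Fin (d + 1) → Matrix (Fin m) (Fin m) ℂ) :
    currentTerm g x C u v = ∑ i, ∑ j, ∑ k, ∑ l, (invGram g x i j : ℂ) * C j k l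
      * (u x l * differential d (fun y => conj (v y k)) x (frame x i)
        - differential d (fun y => u y l) x (frame x i) * conj (v x k)) := by
  unfold currentTerm
  refine Finset.sum_congr rfl fun i _ => Finset.sum_congr rfl fun j _ => ?_
  simp only [herm_mulVec_left, differential_apply hu, differential_conj_apply hv]
  rw [← Finset.sum_sub_distrib, Finset.mul_sum]
  refine Finset.sum_congr rfl fun k _ => ?_
  rw [← Finset.sum_sub_distrib, Finset.mul_sum]
  exact Finset.sum_congr rfl fun l _ => by ring

lemma herm_sum_smul_mulVec (G : Fin (d + 1) → Fin (d + 1) → ℂ)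
    (P : Fin (d + 1) → Fin (d + 1) → Matrix (Fin m) (Fin m) ℂ) (a b : Fin m → ℂ) :
    herm ((∑ i, ∑ j, G i j • P i j) *ᵥ a) b = ∑ i, ∑ j, G i j * herm (P i j *ᵥ a) b := by
  simp only [Matrix.sum_mulVec, herm_sum_left]
  refine Finset.sum_congr rfl fun i _ => Finset.sum_congr rfl fun j _ => ?_
  simp only [herm, Matrix.smul_mulVec, Pi.smul_apply, smul_eq_mul, Finset.mul_sum, mul_assoc]

/-- The zeroth-order part of `⟨d_A u, d_A v⟩` is `-⟨|A|² u, v⟩`, since `A` is skew-Hermitian. -/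
lemma herm_normSq {A : Matrix (Fin m) (Fin m) (OneForm d M)} (hA : IsUnitaryConnection A)
    (u v : M → Fin m → ℂ) (x : M) :
    herm (normSq g A x *ᵥ u x) (v x)
      = -vecFormInner g x (covDeriv A u x - sectionDeriv d u x)
          (covDeriv A v x - sectionDeriv d v x) := by
  rw [normSq, herm_sum_smul_mulVec, sum_invGram_symm]
  simp only [vecFormInner, sub_apply, covDeriv_frame, add_sub_cancel_left, herm_mulVec_right,
    hA.conjTranspose_component, Matrix.mulVec_mulVec, Matrix.neg_mul, Matrix.neg_mulVec,
    herm_neg_left, mul_neg, Finset.sum_neg_distrib, neg_neg]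

/-- Expansion of `⟨d_A u, d_A v⟩`; the mixed terms combine to `currentTerm` because `A` is
skew-Hermitian. -/
lemma vecFormInner_covDeriv {A : Matrix (Fin m) (Fin m) (OneForm d M)}
    (hA : IsUnitaryConnection A) (u v : M → Fin m → ℂ) (x : M) :
    vecFormInner g x (covDeriv A u x) (covDeriv A v x)
      = vecFormInner g x (sectionDeriv d u x) (sectionDeriv d v x)
        - herm (normSq g A x *ᵥ u x) (v x) + currentTerm g x (component A x) u v := by
  have h1 : currentTerm g x (component A x) u v
      = ∑ i, ∑ j, (invGram g x i j : ℂ) *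
          herm (component A x i *ᵥ u x) (sectionDeriv d v x (frame x j))
        - ∑ i, ∑ j, (invGram g x i j : ℂ) *
          herm (component A x j *ᵥ sectionDeriv d u x (frame x i)) (v x) := by
    rw [currentTerm, sum_invGram_symm g x fun i j =>
      herm (component A x i *ᵥ u x) (sectionDeriv d v x (frame x j))]
    simp only [mul_sub, Finset.sum_sub_distrib]
  rw [h1, herm_normSq g hA]
  simp only [vecFormInner, sub_apply, covDeriv_frame, add_sub_cancel_left]
  simp only [← Finset.sum_sub_distrib, ← Finset.sum_add_distrib, sub_neg_eq_add]
  refine Finset.sum_congr rfl fun i _ => Finset.sum_congr rfl fun j _ => ?_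
  rw [herm_add_left, herm_add_right, herm_add_right,
    herm_mulVec_right _ (sectionDeriv d u x (frame x i)), hA.conjTranspose_component,
    Matrix.neg_mulVec, herm_neg_left]
  ring

lemma currentTerm_sub (x : M) (C D : Fin (d + 1) → Matrix (Fin m) (Fin m) ℂ)
    (u v : M → Fin m → ℂ) :
    currentTerm g x (fun j => C j - D j) u v = currentTerm g x C u v - currentTerm g x D u v := by
  simp only [currentTerm, Matrix.sub_mulVec, herm_sub_left, ← Finset.sum_sub_distrib]
  exact Finset.sum_congr rfl fun i _ => Finset.sum_congr rfl fun j _ => by ring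

lemma ContinuousForm.sub {α β : ∀ x : M, TangentSpace (𝓡∂ (d + 1)) x →L[ℝ] (Fin m → ℂ)}
    (hα : ContinuousForm α) (hβ : ContinuousForm β) : ContinuousForm fun x => α x - β x :=
  fun a i => (hα a i).sub (hβ a i)

lemma continuousForm_sectionDeriv {u : M → Fin m → ℂ} (hu : IsSmoothSection d u) :
    ContinuousForm (sectionDeriv d u) :=
  fun a i => continuousOn_mfderiv_chartFrame hu a i

lemma continuous_herm_normSq {A : Matrix (Fin m) (Fin m) (OneForm d M)}
    (hA : IsUnitaryConnection A) {u v : M → Fin m → ℂ} (hu : IsSmoothSection d u)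
    (hv : IsSmoothSection d v) : Continuous fun x => herm (normSq g A x *ᵥ u x) (v x) := by
  simp only [herm_normSq g hA]
  exact (continuous_vecFormInner g
    ((continuousForm_covDeriv hA.smooth hu).sub (continuousForm_sectionDeriv hu))
    ((continuousForm_covDeriv hA.smooth hv).sub (continuousForm_sectionDeriv hv))).neg

lemma continuous_currentTerm {A : Matrix (Fin m) (Fin m) (OneForm d M)}
    (hA : IsUnitaryConnection A) {u v : M → Fin m → ℂ} (hu : IsSmoothSection d u)
    (hv : IsSmoothSection d v) : Continuous fun x => currentTerm g x (component A x) u v := by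
  have h : (fun x => currentTerm g x (component A x) u v) = fun x =>
      vecFormInner g x (covDeriv A u x) (covDeriv A v x)
      - vecFormInner g x (sectionDeriv d u x) (sectionDeriv d v x)
      + herm (normSq g A x *ᵥ u x) (v x) := by
    funext x
    rw [vecFormInner_covDeriv g hA]
    ring
  rw [h]
  exact ((continuous_vecFormInner g (continuousForm_covDeriv hA.smooth hu)
    (continuousForm_covDeriv hA.smooth hv)).sub (continuous_vecFormInner g
    (continuousForm_sectionDeriv hu) (continuousForm_sectionDeriv hv))).add
    (continuous_herm_normSq g hA hu hv)

variable {A B : Matrix (Fin m) (Fin m) (OneForm d M)} {QA QB : M → Matrix (Fin m) (Fin m) ℂ}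

lemma continuous_herm_potential_sub (hA : IsUnitaryConnection A) (hB : IsUnitaryConnection B)
    (hQA : IsSmoothPotential d QA) (hQB : IsSmoothPotential d QB)
    {u v : M → Fin m → ℂ} (hu : IsSmoothSection d u) (hv : IsSmoothSection d v) :
    Continuous fun x =>
      herm ((QA x - QB x + normSq g B x - normSq g A x) *ᵥ u x) (v x) := by
  simp only [Matrix.sub_mulVec, Matrix.add_mulVec, herm_sub_left, herm_add_left]
  exact (((continuous_herm (continuous_potential hQA hu) hv.continuous).sub
    (continuous_herm (continuous_potential hQB hu) hv.continuous)).add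
    (continuous_herm_normSq g hB hu hv)).sub (continuous_herm_normSq g hA hu hv)

lemma continuous_currentTerm_sub (hA : IsUnitaryConnection A) (hB : IsUnitaryConnection B)
    {u v : M → Fin m → ℂ} (hu : IsSmoothSection d u) (hv : IsSmoothSection d v) :
    Continuous fun x => currentTerm g x (fun j => component A x j - component B x j) u v := by
  simp only [currentTerm_sub]
  exact (continuous_currentTerm g hA hu hv).sub (continuous_currentTerm g hB hu hv)

/-- For `m = 1`, skewness turns the conjugate of `(B - A)ⱼ` in `formInner` into `(A - B)ⱼ`. -/
lemma formInner_eq_currentTerm (hA : IsUnitaryConnection A) (hB : IsUnitaryConnection B)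
    (hm : m = 1) (k : Fin m) {u v : M → Fin m → ℂ} (hu : IsSmoothSection d u)
    (hv : IsSmoothSection d v) (x : M) :
    formInner g x (u x k • differential d (fun y => conj (v y k)) x
        - conj (v x k) • differential d (fun y => u y k) x) (B k k x - A k k x)
      = currentTerm g x (fun j => component A x j - component B x j) u v := by
  have hk : ∀ F : Fin m → ℂ, ∑ l, F l = F k := fun F => by
    subst hm
    rw [Fin.sum_univ_one, Subsingleton.elim 0 k]
  rw [currentTerm_eq_sum g hu hv, formInner]
  refine Finset.sum_congr rfl fun i _ => Finset.sum_congr rfl fun j _ => ?_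
  rw [hk, hk, sub_apply, sub_apply, map_sub, hA.conj_apply, hB.conj_apply]
  change _ * ((u x k * differential d (fun y => conj (v y k)) x (frame x i)
    - conj (v x k) * differential d (fun y => u y k) x (frame x i)) * _)
    = _ * (A k k x _ - B k k x _) * _
  ring

lemma trace_mul_conjTranspose (X Y : Matrix (Fin m) (Fin m) ℂ) :
    (X * Yᴴ).trace = ∑ r, herm (fun k => X k r) (fun k => Y k r) := by
  simp only [Matrix.trace, Matrix.diag_apply, Matrix.mul_apply, Matrix.conjTranspose_apply, herm]
  exact Finset.sum_comm

/-- The pairing of the matrix current `U (dV^*) - (dU) V^*` with `B - A` is the sum over the columns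
of the first-order terms for `A - B`. -/
lemma trace_current (hA : IsUnitaryConnection A) (hB : IsUnitaryConnection B)
    {U V : M → Matrix (Fin m) (Fin m) ℂ} (hU : ∀ r, IsSmoothSection d fun x k => U x k r)
    (hV : ∀ r, IsSmoothSection d fun x k => V x k r) (x : M) :
    ∑ i, ∑ j, (invGram g x i j : ℂ)
        * (component (currentMatrix d U V) x i * (component (B - A) x j)ᴴ).trace
      = ∑ r, currentTerm g x (fun j => component A x j - component B x j)
          (fun x k => U x k r) (fun x k => V x k r) := by
  have hBA : ∀ j, (component (B - A) x j)ᴴ = component A x j - component B x j := fun j => by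
    change (component B x j - component A x j)ᴴ = _
    rw [Matrix.conjTranspose_sub, hA.conjTranspose_component, hB.conjTranspose_component]
    abel
  have hcur : ∀ i k l, component (currentMatrix d U V) x i k l
      = ∑ r, (U x k r * differential d (fun y => conj (V y l r)) x (frame x i)
        - conj (V x l r) * differential d (fun y => U y k r) x (frame x i)) := fun i k l => by
    change (∑ r, (U x k r • differential d (fun y => (V y)ᴴ r l) x
      - (V x)ᴴ r l • differential d (fun y => U y k r) x)) (frame x i) = _
    rw [sum_apply]
    rfl
  rw [Finset.sum_congr rfl fun r _ => currentTerm_eq_sum g (hU r) (hV r) x _]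
  conv_rhs => rw [Finset.sum_comm]
  refine Finset.sum_congr rfl fun i _ => ?_
  conv_rhs => rw [Finset.sum_comm]
  refine Finset.sum_congr rfl fun j _ => ?_
  rw [hBA]
  simp only [Matrix.trace, Matrix.diag_apply, Matrix.mul_apply, hcur, Finset.sum_mul,
    Finset.mul_sum]
  rw [Finset.sum_comm]
  conv_rhs => rw [Finset.sum_comm]
  refine Finset.sum_congr rfl fun k _ => ?_
  conv_rhs => rw [Finset.sum_comm]
  refine Finset.sum_congr rfl fun l _ => Finset.sum_congr rfl fun r _ => ?_
  ring

end Algebra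

/-! ### Solutions of the Dirichlet problem and the integral identity -/

section Solutions

variable {d m : ℕ} {M : Type*} [TopologicalSpace M]
  [ChartedSpace (EuclideanHalfSpace (d + 1)) M] [IsManifold (𝓡∂ (d + 1)) ∞ M]
  [CompactSpace M] [T2Space M] [MeasurableSpace M] [BorelSpace M] (g : Metric d M)

/-- Green's formula for a solution of the Dirichlet problem. -/
lemma IsDirichletSolution.green {A : Matrix (Fin m) (Fin m) (OneForm d M)}
    (hA : IsUnitaryConnection A) {Q : M → Matrix (Fin m) (Fin m) ℂ} (hQ : IsSmoothPotential d Q)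
    {f : (𝓡∂ (d + 1)).boundary M → Fin m → ℂ} {u : M → Fin m → ℂ}
    (hu : IsDirichletSolution g A Q f u) {φ : M → Fin m → ℂ} (hφ : IsSmoothSection d φ) :
    ∫ p : (𝓡∂ (d + 1)).boundary M, herm (covDeriv A u p (outwardNormal g p)) (φ p)
        ∂(surfaceMeasure g)
      = ∫ x, (vecFormInner g x (covDeriv A u x) (covDeriv A φ x) + herm (Q x *ᵥ u x) (φ x))
        ∂(volumeMeasure g) := by
  rw [ConnectionCalderon.green g hA.smooth (continuousForm_covDeriv hA.smooth hu.smooth)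
    (continuous_potential hQ hu.smooth).neg hu.equation hφ]
  refine integral_congr_ae (Eventually.of_forall fun x => ?_)
  beta_reduce
  rw [Pi.neg_apply, herm_neg_left, sub_neg_eq_add]

/-- Green's formula for a solution of the adjoint problem, with the roles of the solution and of
the test section exchanged by conjugation. -/
lemma IsDirichletSolution.green_adjoint {A : Matrix (Fin m) (Fin m) (OneForm d M)}
    (hA : IsUnitaryConnection A) {Q : M → Matrix (Fin m) (Fin m) ℂ} (hQ : IsSmoothPotential d Q)
    {f : (𝓡∂ (d + 1)).boundary M → Fin m → ℂ} {v : M → Fin m → ℂ}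
    (hv : IsDirichletSolution g A (fun x => (Q x)ᴴ) f v) {φ : M → Fin m → ℂ}
    (hφ : IsSmoothSection d φ) :
    conj (∫ p : (𝓡∂ (d + 1)).boundary M, herm (covDeriv A v p (outwardNormal g p)) (φ p)
        ∂(surfaceMeasure g))
      = ∫ x, (vecFormInner g x (covDeriv A φ x) (covDeriv A v x) + herm (Q x *ᵥ φ x) (v x))
        ∂(volumeMeasure g) := by
  have hQ' : IsSmoothPotential d fun x => (Q x)ᴴ := fun k l =>
    ((Complex.conjCLE : ℂ →L[ℝ] ℂ).contDiff (n := ∞)).contMDiff.comp (hQ l k)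
  rw [hv.green g hA hQ' hφ, ← integral_conj]
  refine integral_congr_ae (Eventually.of_forall fun x => ?_)
  beta_reduce
  rw [map_add, conj_vecFormInner, conj_herm, herm_mulVec_right, Matrix.conjTranspose_conjTranspose]

lemma IsDirichletSolution.sub {A : Matrix (Fin m) (Fin m) (OneForm d M)}
    (hA : IsUnitaryConnection A) {Q : M → Matrix (Fin m) (Fin m) ℂ} (hQ : IsSmoothPotential d Q)
    {f : (𝓡∂ (d + 1)).boundary M → Fin m → ℂ} {u w : M → Fin m → ℂ}
    (hu : IsDirichletSolution g A Q f u) (hw : IsDirichletSolution g A Q f w) :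
    IsDirichletSolution g A Q (fun _ => 0) (fun x => u x - w x) where
  smooth := ContMDiff.sub hu.smooth hw.smooth
  boundary p := by rw [hu.boundary, hw.boundary, sub_self]
  equation φ hφ hc hs := by
    have h1 := hu.equation φ hφ hc hs
    have h2 := hw.equation φ hφ hc hs
    have i1 : ∀ {z : M → Fin m → ℂ}, IsSmoothSection d z →
        Integrable (fun x => vecFormInner g x (covDeriv A z x) (covDeriv A φ x))
          (volumeMeasure g) := fun hz => integrable_volumeMeasure g
      (continuous_vecFormInner g (continuousForm_covDeriv hA.smooth hz)
        (continuousForm_covDeriv hA.smooth hφ))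
    have i2 : ∀ {z : M → Fin m → ℂ}, IsSmoothSection d z →
        Integrable (fun x => herm (-(Q x *ᵥ z x)) (φ x)) (volumeMeasure g) := fun hz =>
      integrable_volumeMeasure g (continuous_herm (continuous_potential hQ hz).neg hφ.continuous)
    have e1 : ∀ x, herm (-(Q x *ᵥ (u x - w x))) (φ x)
        = herm (-(Q x *ᵥ u x)) (φ x) - herm (-(Q x *ᵥ w x)) (φ x) := fun x => by
      rw [Matrix.mulVec_sub, ← herm_sub_left]
      congr 1
      abel
    have e2 : ∀ x, vecFormInner g x (covDeriv A (fun y => u y - w y) x) (covDeriv A φ x)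
        = vecFormInner g x (covDeriv A u x) (covDeriv A φ x)
          - vecFormInner g x (covDeriv A w x) (covDeriv A φ x) := fun x => by
      rw [covDeriv_sub A (hu.smooth.mdifferentiableAt x) (hw.smooth.mdifferentiableAt x),
        vecFormInner_sub_left]
    simp only [e1, e2]
    rw [integral_sub (i2 hu.smooth) (i2 hw.smooth), integral_sub (i1 hu.smooth) (i1 hw.smooth),
      h1, h2]

/-- The Dirichlet-to-Neumann map may be computed from any solution: by uniqueness it is the chosen
one. -/
lemma IsDirichletSolution.dnMap_eq {A : Matrix (Fin m) (Fin m) (OneForm d M)}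
    (hA : IsUnitaryConnection A) {Q : M → Matrix (Fin m) (Fin m) ℂ} (hQ : IsSmoothPotential d Q)
    (h0 : ZeroNotDirichletEigenvalue g A Q)
    {f : (𝓡∂ (d + 1)).boundary M → Fin m → ℂ} {u : M → Fin m → ℂ}
    (hu : IsDirichletSolution g A Q f u) :
    dnMap g A Q f = fun p => covDeriv A u p.1 (outwardNormal g p.1) := by
  have h : ∃ u, IsDirichletSolution g A Q f u := ⟨u, hu⟩
  have he : h.choose = u := by
    have := h0 _ (h.choose_spec.sub g hA hQ hu)
    funext x
    exact sub_eq_zero.1 (congrFun this x)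
  rw [dnMap, dif_pos h, he]

lemma integrable_normal {A : Matrix (Fin m) (Fin m) (OneForm d M)}
    (hA : IsUnitaryConnection A) {u φ : M → Fin m → ℂ} (hu : IsSmoothSection d u)
    (hφ : IsSmoothSection d φ) :
    Integrable (fun p : (𝓡∂ (d + 1)).boundary M =>
      herm (covDeriv A u p (outwardNormal g p)) (φ p)) (surfaceMeasure g) :=
  integrable_surfaceMeasure g (ψ := fun x => herm (covDeriv A u x (outwardNormal g x)) (φ x))
    (integrable_boundary g (continuousForm_covDeriv hA.smooth hu) hφ.continuous)

variable {A B : Matrix (Fin m) (Fin m) (OneForm d M)} {QA QB : M → Matrix (Fin m) (Fin m) ℂ}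

/-- The integral identity for sections. -/
theorem innerBdry_dnMap_sub (hA : IsUnitaryConnection A) (hB : IsUnitaryConnection B)
    (hQA : IsSmoothPotential d QA) (hQB : IsSmoothPotential d QB)
    (h0A : ZeroNotDirichletEigenvalue g A QA) (h0B : ZeroNotDirichletEigenvalue g B QB)
    {f f' : (𝓡∂ (d + 1)).boundary M → Fin m → ℂ} {u v w : M → Fin m → ℂ}
    (hu : IsDirichletSolution g A QA f u)
    (hv : IsDirichletSolution g B (fun x => (QB x)ᴴ) f' v)
    (hw : IsDirichletSolution g B QB f w) :
    innerBdry g (fun p => dnMap g A QA f p - dnMap g B QB f p) f'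
      = innerM g (fun x => (QA x - QB x + normSq g B x - normSq g A x) *ᵥ u x) v
        + ∫ x, currentTerm g x (fun j => component A x j - component B x j) u v
          ∂(volumeMeasure g) := by
  have hbd : ∫ p : (𝓡∂ (d + 1)).boundary M, herm (covDeriv B w p (outwardNormal g p)) (v p)
        ∂(surfaceMeasure g)
      = ∫ x, (vecFormInner g x (covDeriv B u x) (covDeriv B v x) + herm (QB x *ᵥ u x) (v x))
        ∂(volumeMeasure g) := by
    -- Only the boundary values of `w` enter the adjoint Green formula, and they are those of `u`.
    rw [hw.green g hB hQB hv.smooth, ← hv.green_adjoint g hB hQB hw.smooth,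
      ← hv.green_adjoint g hB hQB hu.smooth]
    simp only [hw.boundary, hu.boundary]
  have i1 : ∀ {C : Matrix (Fin m) (Fin m) (OneForm d M)} {Q : M → Matrix (Fin m) (Fin m) ℂ},
      IsUnitaryConnection C → IsSmoothPotential d Q →
      Integrable (fun x => vecFormInner g x (covDeriv C u x) (covDeriv C v x)
        + herm (Q x *ᵥ u x) (v x)) (volumeMeasure g) := fun hC hQ =>
    integrable_volumeMeasure g ((continuous_vecFormInner g
      (continuousForm_covDeriv hC.smooth hu.smooth)
      (continuousForm_covDeriv hC.smooth hv.smooth)).add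
      (continuous_herm (continuous_potential hQ hu.smooth) hv.smooth.continuous))
  rw [innerBdry, hu.dnMap_eq g hA hQA h0A, hw.dnMap_eq g hB hQB h0B]
  simp only [herm_sub_left, ← hv.boundary]
  rw [integral_sub (integrable_normal g hA hu.smooth hv.smooth)
    (integrable_normal g hB hw.smooth hv.smooth), hbd,
    hu.green g hA hQA hv.smooth, ← integral_sub (i1 hA hQA) (i1 hB hQB), innerM, ← integral_add
    (integrable_volumeMeasure g
      (continuous_herm_potential_sub g hA hB hQA hQB hu.smooth hv.smooth))
    (integrable_volumeMeasure g (continuous_currentTerm_sub g hA hB hu.smooth hv.smooth))]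
  refine integral_congr_ae (Eventually.of_forall fun x => ?_)
  beta_reduce
  rw [vecFormInner_covDeriv g hA, vecFormInner_covDeriv g hB, currentTerm_sub]
  simp only [Matrix.sub_mulVec, Matrix.add_mulVec, herm_sub_left, herm_add_left]
  ring

lemma innerMatrixBdry_dnMapMatrix_sub (hA : IsUnitaryConnection A) (hB : IsUnitaryConnection B)
    (hQA : IsSmoothPotential d QA) (hQB : IsSmoothPotential d QB)
    (h0A : ZeroNotDirichletEigenvalue g A QA) (h0B : ZeroNotDirichletEigenvalue g B QB)
    {F G : (𝓡∂ (d + 1)).boundary M → Matrix (Fin m) (Fin m) ℂ}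
    {U V W : M → Matrix (Fin m) (Fin m) ℂ} (hU : IsDirichletSolutionMatrix g A QA F U)
    (hV : IsDirichletSolutionMatrix g B (fun x => (QB x)ᴴ) G V)
    (hW : IsDirichletSolutionMatrix g B QB F W) :
    innerMatrixBdry g (fun p => dnMapMatrix g A QA F p - dnMapMatrix g B QB F p) G
      = ∑ r, innerBdry g (fun p => dnMap g A QA (fun q l => F q l r) p
          - dnMap g B QB (fun q l => F q l r) p) (fun p k => G p k r) := by
  have hint : ∀ r, Integrable (fun p => herm (dnMap g A QA (fun q l => F q l r) p
      - dnMap g B QB (fun q l => F q l r) p) (fun k => G p k r)) (surfaceMeasure g) := by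
    intro r
    have i1 := integrable_normal g hA (hU r).smooth (hV r).smooth
    have i2 := integrable_normal g hB (hW r).smooth (hV r).smooth
    refine (i1.sub i2).congr (Eventually.of_forall fun p => ?_)
    have hb : (fun k => V p.1 k r) = fun k => G p k r := (hV r).boundary p
    rw [(hU r).dnMap_eq g hA hQA h0A, (hW r).dnMap_eq g hB hQB h0B, Pi.sub_apply]
    exact (herm_sub_left _ _ _).symm.trans (congrArg (herm _) hb)
  unfold innerMatrixBdry innerBdry
  rw [← integral_finsetSum _ fun r _ => hint r]
  exact integral_congr_ae (Eventually.of_forall fun p => trace_mul_conjTranspose _ _)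

lemma innerMatrixM_eq_sum (hA : IsUnitaryConnection A) (hB : IsUnitaryConnection B)
    (hQA : IsSmoothPotential d QA) (hQB : IsSmoothPotential d QB)
    {U V : M → Matrix (Fin m) (Fin m) ℂ} (hU : ∀ r, IsSmoothSection d fun x k => U x k r)
    (hV : ∀ r, IsSmoothSection d fun x k => V x k r) :
    innerMatrixM g (fun x => (QA x - QB x + normSq g B x - normSq g A x) * U x) V
      = ∑ r, innerM g (fun x => (QA x - QB x + normSq g B x - normSq g A x) *ᵥ
          fun k => U x k r) (fun x k => V x k r) := by
  unfold innerMatrixM innerM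
  rw [← integral_finsetSum _ fun r _ => integrable_volumeMeasure g
    (continuous_herm_potential_sub g hA hB hQA hQB (hU r) (hV r))]
  exact integral_congr_ae (Eventually.of_forall fun x => trace_mul_conjTranspose _ _)

lemma innerMatrixForm_current (hA : IsUnitaryConnection A) (hB : IsUnitaryConnection B)
    {U V : M → Matrix (Fin m) (Fin m) ℂ} (hU : ∀ r, IsSmoothSection d fun x k => U x k r)
    (hV : ∀ r, IsSmoothSection d fun x k => V x k r) :
    innerMatrixForm g (currentMatrix d U V) (B - A)
      = ∑ r, ∫ x, currentTerm g x (fun j => component A x j - component B x j)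
          (fun x k => U x k r) (fun x k => V x k r) ∂(volumeMeasure g) := by
  unfold innerMatrixForm
  rw [← integral_finsetSum _ fun r _ => integrable_volumeMeasure g
    (continuous_currentTerm_sub g hA hB (hU r) (hV r))]
  exact integral_congr_ae (Eventually.of_forall fun x => trace_current g hA hB hU hV x)

end Solutions

end ConnectionCalderon

end

theorem theorem2p3 {d m : ℕ} {M : Type*} [TopologicalSpace M]
    [ChartedSpace (EuclideanHalfSpace (d + 1)) M] [IsManifold (𝓡∂ (d + 1)) ∞ M]
    [CompactSpace M] [T2Space M] [MeasurableSpace M] [BorelSpace M]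
    (g : Metric d M)
    (A B : Matrix (Fin m) (Fin m) (OneForm d M)) (QA QB : M → Matrix (Fin m) (Fin m) ℂ)
    (hA : IsUnitaryConnection A) (hB : IsUnitaryConnection B)
    (hQA : IsSmoothPotential d QA) (hQB : IsSmoothPotential d QB)
    (h0A : ZeroNotDirichletEigenvalue g A QA) (h0B : ZeroNotDirichletEigenvalue g B QB) :
    (∀ (f f' : (𝓡∂ (d + 1)).boundary M → Fin m → ℂ) (u v : M → Fin m → ℂ),
      IsDirichletSolution g A QA f u →
      IsDirichletSolution g B (fun x => (QB x)ᴴ) f' v →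
      (∃ w, IsDirichletSolution g B QB f w) →
      innerBdry g (fun p => dnMap g A QA f p - dnMap g B QB f p) f'
          = innerM g (fun x => (QA x - QB x + normSq g B x - normSq g A x) *ᵥ u x) v
            + ∫ x, ∑ i, ∑ j, ∑ k, ∑ l,
                (invGram g x i j : ℂ) * (component A x j - component B x j) k l
                  * (u x l * differential d (fun y => conj (v y k)) x (frame x i)
                      - differential d (fun y => u y l) x (frame x i) * conj (v x k))
                ∂(volumeMeasure g)
      ∧ (m = 1 → ∀ k : Fin m,
        innerBdry g (fun p => dnMap g A QA f p - dnMap g B QB f p) f'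
          = innerM g (fun x => (QA x - QB x + normSq g B x - normSq g A x) *ᵥ u x) v
            + ∫ x, formInner g x
                (u x k • differential d (fun y => conj (v y k)) x
                  - conj (v x k) • differential d (fun y => u y k) x)
                (B k k x - A k k x)
                ∂(volumeMeasure g)))
    ∧ (∀ (F G : (𝓡∂ (d + 1)).boundary M → Matrix (Fin m) (Fin m) ℂ)
        (U V : M → Matrix (Fin m) (Fin m) ℂ),
      IsDirichletSolutionMatrix g A QA F U →
      IsDirichletSolutionMatrix g B (fun x => (QB x)ᴴ) G V →
      (∃ W, IsDirichletSolutionMatrix g B QB F W) →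
      innerMatrixBdry g (fun p => dnMapMatrix g A QA F p - dnMapMatrix g B QB F p) G
          = innerMatrixM g (fun x => (QA x - QB x + normSq g B x - normSq g A x) * U x) V
            + innerMatrixForm g (currentMatrix d U V) (B - A)) := by
  refine ⟨fun f f' u v hu hv ⟨w, hw⟩ => ?_, fun F G U V hU hV ⟨W, hW⟩ => ?_⟩
  · have key := innerBdry_dnMap_sub g hA hB hQA hQB h0A h0B hu hv hw
    refine ⟨?_, fun hm k => ?_⟩
    · rw [key]
      simp only [currentTerm_eq_sum g hu.smooth hv.smooth, Matrix.sub_apply]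
    · rw [key]
      simp only [formInner_eq_currentTerm g hA hB hm k hu.smooth hv.smooth]
  · have key := fun r => innerBdry_dnMap_sub g hA hB hQA hQB h0A h0B (hU r) (hV r) (hW r)
    rw [innerMatrixBdry_dnMapMatrix_sub g hA hB hQA hQB h0A h0B hU hV hW,
      innerMatrixM_eq_sum g hA hB hQA hQB (fun r => (hU r).smooth) (fun r => (hV r).smooth),
      innerMatrixForm_current g hA hB (fun r => (hU r).smooth) (fun r => (hV r).smooth),
      Finset.sum_congr rfl fun r _ => key r, Finset.sum_add_distrib]
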